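/- A twofold triple system TTS($v$) consists of a set $V$ of $v$ points together with a collection $\mathcal{B}$ of 3-element subsets of $V$ (blocks, or triples; repeated blocks are allowed) such that every 2-element subset of $V$ is contained in exactly two blocks, counted with multiplicity. Its 2-block-intersection graph (2-BIG) is the graph whose vertices are the blocks (a block of multiplicity $m$ giving $m$ vertices), two distinct vertices being adjacent if and only if the corresponding blocks intersect in exactly two points. A graph is Hamiltonian if it has a cycle that passes through every vertex exactly once. Theorem. If $v\ge 7$ is odd and there exists a TTS($v$) with a Hamiltonian 2-BIG, then there exists a TTS($3v+3$) with a Hamiltonian 2-BIG. -/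

import Mathlib

/-- A balanced incomplete block design BIBD(`v`, `k`, `lam`) on the finite point type `V`, where
`v = Fintype.card V`.  The blocks form a multiset, so that a block may be repeated (as in the
twofold triple system on three points). -/
structure BIBD (V : Type*) [Fintype V] [DecidableEq V] (v k lam : ℕ) where
  /-- The multiset of blocks. -/
  blocks : Multiset (Finset V)
  /-- There are `v` points. -/
  card_points : Fintype.card V = v
  /-- Every block has `k` points. -/
  card_block : ∀ B ∈ blocks, B.card = k
  /-- Every 2-subset of the point set occurs in exactly `lam` blocks, counted with multiplicity. -/
  pair_count : ∀ P : Finset V, P.card = 2 → blocks.countP (fun B => P ⊆ B) = lam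

/-- A twofold triple system TTS(`v`) on the point type `V`. -/
abbrev TTS (V : Type*) [Fintype V] [DecidableEq V] (v : ℕ) := BIBD V v 3 2

namespace BIBD

variable {V : Type*} [Fintype V] [DecidableEq V] {v k lam : ℕ}

instance instDecidableEqBlocks (D : BIBD V v k lam) : DecidableEq D.blocks.ToType :=
  inferInstanceAs (DecidableEq ((B : Finset V) × Fin (D.blocks.count B)))

/-- The `i`-block-intersection graph of a design: its vertices are the blocks (a block of
multiplicity `m` gives `m` vertices), and two different vertices are adjacent if and only if the
corresponding blocks meet in exactly `i` points. -/
def blockIntersectionGraph (D : BIBD V v k lam) (i : ℕ) : SimpleGraph D.blocks.ToType where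
  Adj B₁ B₂ := B₁ ≠ B₂ ∧ ((B₁.1 : Finset V) ∩ (B₂.1 : Finset V)).card = i
  symm := ⟨fun B₁ B₂ h => ⟨h.1.symm, by rw [Finset.inter_comm]; exact h.2⟩⟩
  loopless := ⟨fun _ h => h.1 rfl⟩

end BIBD

/-! A TTS(N + 1) with N = 3v + 2 is built directly on ℤ/N ∪ {∞}. Its blocks are the N translates of
n = (N - 2)/3 base triples in ℤ/N and of one triple {∞, 0, d}. If the differences ±d occur in a base
triple and every other nonzero difference occurs in two base triples, every pair is covered at least
twice; the number of triples then forces exactly twice (`card_filter_subset_eq_two`).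

The Hamiltonian cycle comes from the order of the base triples: neighbours in the order share two
points, and the last one shares two points with the first one translated by a unit c. Running
through the order N times, with a shift by c after each round, gives a cycle through all translates
of base triples. The triples {∞, j, j + d} form a path when j decreases by d. The path fits in if
its two end pairs {j₀, j₀ + d} and {j₀ + d, j₀ + 2d} lie in the two ends of a Hamiltonian path of
the finite part (`exists_tts_of_rotational`). These ends are two translates, by 0 and by d, of the
base triple that contains the difference d. They are far apart on the cycle, so it is cut into four
or five segments that are rejoined, some reversed, along chords: translates of two base triples with
a common difference, aligned on that pair.

Both explicit families consist of two fans of triples, one with apex 0 over a zigzag and one with a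
second apex over another zigzag, linked by a few connecting triples. In a fan, consecutive triples
share the apex and one zigzag term. -/

/-- A cyclic list of pairwise adjacent vertices that runs through every vertex once gives a
Hamiltonian graph. -/
theorem isHamiltonian_of_list {α : Type*} [Fintype α] {_ : DecidableEq α} (G : SimpleGraph α)
    (l : List α) (hne : l ≠ []) (hnd : l.Nodup) (hmem : ∀ a, a ∈ l) (hlen : 3 ≤ l.length)
    (hchain : l.IsChain G.Adj) (hclose : G.Adj (l.getLast hne) (l.head hne)) :
    G.IsHamiltonian := by
  intro _
  set w := SimpleGraph.Walk.ofSupport (G := G) l hne hchain with hw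
  have hsupp : w.support = l := SimpleGraph.Walk.support_ofSupport hne hchain
  have hpath : w.IsPath := by rw [SimpleGraph.Walk.isPath_def, hsupp]; exact hnd
  have hlen' : w.length = l.length - 1 := SimpleGraph.Walk.length_ofSupport hne hchain
  have hcard : l.length = Fintype.card α := by
    rw [← List.toFinset_card_of_nodup hnd, ← Finset.card_univ]
    congr 1
    ext a
    simp [hmem a]
  refine ⟨_, SimpleGraph.Walk.cons hclose w, ?_⟩
  rw [SimpleGraph.Walk.isHamiltonianCycle_iff_isCycle_and_length_eq]
  refine ⟨?_, ?_⟩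
  · rw [SimpleGraph.Walk.cons_isCycle_iff]
    refine ⟨hpath, fun he => ?_⟩
    -- A path that uses the edge between its own ends has length one, but here the length is at
    -- least two.
    have := hpath.length_eq_one_of_mem_edges (Sym2.eq_swap ▸ he)
    omega
  · simp only [SimpleGraph.Walk.length_cons]
    omega

/-- Vertices of the 2-BIG are blocks with a copy number. This identification allows work with
indices, so equal triples with different indices need no separate treatment. -/
theorem exists_equiv_toType_map {ι β : Type*} [Fintype ι] [DecidableEq ι] [DecidableEq β]
    (f : ι → β) :
    ∃ e : ι ≃ ((Finset.univ : Finset ι).val.map f).ToType, ∀ i, (e i).1 = f i := by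
  have hc : ∀ i : ι, (Finset.univ : Finset ι).val.count i = 1 := fun i =>
    Multiset.count_eq_one_of_mem Finset.univ.nodup (Finset.mem_univ i)
  let e₀ : ι ≃ ((Finset.univ : Finset ι).val).ToType :=
    { toFun := fun i => ⟨i, ⟨0, by rw [hc]; exact Nat.one_pos⟩⟩
      invFun := fun x => x.1
      left_inv := fun _ => rfl
      right_inv := by
        rintro ⟨i, j⟩
        have : j = ⟨0, by rw [hc]; exact Nat.one_pos⟩ := by
          apply Fin.ext
          have := j.2.trans_eq (hc i)
          exact Nat.lt_one_iff.mp this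
        rw [this] }
  exact ⟨e₀.trans (Multiset.mapEquiv _ f), fun i => Multiset.mapEquiv_apply _ f (e₀ i)⟩

/-- If every pair of points lies in at least two triples and there are `v (v - 1) / 3` triples,
then every pair lies in exactly two of them. -/
theorem card_filter_subset_eq_two {V ι : Type*} [Fintype V] [DecidableEq V] [Fintype ι]
    [DecidableEq ι] (blk : ι → Finset V) (hcard : ∀ i, (blk i).card = 3)
    (hpair : ∀ x y, x ≠ y → ∃ i j, i ≠ j ∧ x ∈ blk i ∧ y ∈ blk i ∧ x ∈ blk j ∧ y ∈ blk j)
    (hcount : 3 * Fintype.card ι = Fintype.card V * (Fintype.card V - 1))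
    (P : Finset V) (hP : P.card = 2) :
    (Finset.univ.filter fun i => P ⊆ blk i).card = 2 := by
  have hle : ∀ Q ∈ Finset.powersetCard 2 (Finset.univ : Finset V),
      2 ≤ (Finset.univ.filter fun i => Q ⊆ blk i).card := by
    intro Q hQ
    obtain ⟨x, y, hxy, rfl⟩ := Finset.card_eq_two.mp (Finset.mem_powersetCard.mp hQ).2
    obtain ⟨i, j, hij, h1, h2, h3, h4⟩ := hpair x y hxy
    rw [← Finset.card_pair hij]
    apply Finset.card_le_card
    intro k hk
    rw [Finset.mem_insert, Finset.mem_singleton] at hk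
    rw [Finset.mem_filter]
    refine ⟨Finset.mem_univ _, ?_⟩
    rcases hk with rfl | rfl <;> simp [Finset.insert_subset_iff, *]
  -- Double counting of incidences: each triple contains three pairs.
  have hsum : ∑ Q ∈ Finset.powersetCard 2 (Finset.univ : Finset V),
      (Finset.univ.filter fun i => Q ⊆ blk i).card = 3 * Fintype.card ι := by
    simp_rw [Finset.card_filter]
    rw [Finset.sum_comm]
    have : ∀ i : ι, (∑ Q ∈ Finset.powersetCard 2 (Finset.univ : Finset V),
        if Q ⊆ blk i then 1 else 0) = 3 := by
      intro i
      rw [← Finset.card_filter]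
      have : (Finset.powersetCard 2 (Finset.univ : Finset V)).filter (fun Q => Q ⊆ blk i) =
          Finset.powersetCard 2 (blk i) := by
        ext Q
        simp [Finset.mem_powersetCard, and_comm]
      rw [this, Finset.card_powersetCard, hcard]
      rfl
    simp [this, mul_comm]
  have hconst : ∑ _Q ∈ Finset.powersetCard 2 (Finset.univ : Finset V), 2 = 3 * Fintype.card ι := by
    rw [Finset.sum_const, Finset.card_powersetCard, Finset.card_univ, smul_eq_mul, hcount,
      Nat.choose_two_right]
    exact Nat.div_mul_cancel (Nat.even_mul_pred_self _).two_dvd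
  -- Termwise inequality with equal sums forces equality in every term.
  have := (Finset.sum_eq_sum_iff_of_le hle).mp (hconst.trans hsum.symm) P
    (Finset.mem_powersetCard.mpr ⟨Finset.subset_univ _, hP⟩)
  exact this.symm

theorem exists_tts_fin_of_blocks {ι : Type*} [Fintype ι] [DecidableEq ι] {v : ℕ}
    (blk : ι → Finset (Fin v)) (hcard : ∀ i, (blk i).card = 3)
    (hpair : ∀ x y, x ≠ y → ∃ i j, i ≠ j ∧ x ∈ blk i ∧ y ∈ blk i ∧ x ∈ blk j ∧ y ∈ blk j)
    (hcount : 3 * Fintype.card ι = v * (v - 1))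
    (l : List ι) (hne : l ≠ []) (hnd : l.Nodup) (hmem : ∀ a, a ∈ l) (hlen : 3 ≤ l.length)
    (hchain : l.IsChain fun i j => (blk i ∩ blk j).card = 2)
    (hclose : (blk (l.getLast hne) ∩ blk (l.head hne)).card = 2) :
    ∃ D : TTS (Fin v) v, (D.blockIntersectionGraph 2).IsHamiltonian := by
  let D : TTS (Fin v) v :=
    { blocks := (Finset.univ : Finset ι).val.map blk
      card_points := Fintype.card_fin v
      card_block := by
        intro B hB
        obtain ⟨i, -, rfl⟩ := Multiset.mem_map.mp hB
        exact hcard i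
      pair_count := by
        intro P hP
        rw [Multiset.countP_map]
        have := card_filter_subset_eq_two blk hcard hpair (by simpa using hcount) P hP
        simpa [Finset.card_def] using this }
  obtain ⟨e, he⟩ := exists_equiv_toType_map blk
  have hadj : ∀ i j, (blk i ∩ blk j).card = 2 →
      (D.blockIntersectionGraph 2).Adj (e i) (e j) := by
    intro i j h
    refine ⟨fun hij => ?_, ?_⟩
    · have := e.injective hij
      subst this
      rw [Finset.inter_self, hcard] at h
      omega
    · rw [he, he]
      exact h
  refine ⟨D, isHamiltonian_of_list _ (l.map e) (by simpa using hne) (hnd.map e.injective) ?_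
    (by simpa using hlen) (List.isChain_map_of_isChain e hadj hchain) ?_⟩
  · intro a
    exact List.mem_map.mpr ⟨e.symm a, hmem _, e.apply_symm_apply a⟩
  · rw [List.getLast_map, List.head_map]
    exact hadj _ _ hclose

/-- A family of triples on `v` points that covers every pair of points twice, listed cyclically so
that consecutive triples share two points, gives a twofold triple system with a Hamiltonian
2-block-intersection graph. -/
theorem exists_tts_of_blocks {V ι : Type*} [Fintype V] [DecidableEq V] [Fintype ι]
    [DecidableEq ι] {v : ℕ} (hV : Fintype.card V = v)
    (blk : ι → Finset V) (hcard : ∀ i, (blk i).card = 3)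
    (hpair : ∀ x y, x ≠ y → ∃ i j, i ≠ j ∧ x ∈ blk i ∧ y ∈ blk i ∧ x ∈ blk j ∧ y ∈ blk j)
    (hcount : 3 * Fintype.card ι = v * (v - 1))
    (l : List ι) (hne : l ≠ []) (hnd : l.Nodup) (hmem : ∀ a, a ∈ l) (hlen : 3 ≤ l.length)
    (hchain : l.IsChain fun i j => (blk i ∩ blk j).card = 2)
    (hclose : (blk (l.getLast hne) ∩ blk (l.head hne)).card = 2) :
    ∃ D : TTS (Fin v) v, (D.blockIntersectionGraph 2).IsHamiltonian := by
  let e : V ≃ Fin v := Fintype.equivFinOfCardEq hV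
  refine exists_tts_fin_of_blocks (fun i => (blk i).map e.toEmbedding) ?_ ?_ hcount l hne hnd hmem
    hlen ?_ ?_
  · intro i
    rw [Finset.card_map, hcard]
  · intro x y hxy
    obtain ⟨i, j, hij, h⟩ := hpair (e.symm x) (e.symm y) (by simpa using hxy)
    exact ⟨i, j, hij, by simpa [Finset.mem_map_equiv] using h⟩
  · simpa only [← Finset.map_inter, Finset.card_map] using hchain
  · simpa only [← Finset.map_inter, Finset.card_map] using hclose

/-! ### Rerouting a sequence of naturals through chords -/

section Segments

variable {R : ℕ → ℕ → Prop}

/-- The list of the naturals `a, a + 1, …, b - 1`. -/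
abbrev natSegment (a b : ℕ) : List ℕ := List.range' a (b - a)

theorem isChain_natSegment (h : ∀ p, R p (p + 1)) (a b : ℕ) : (natSegment a b).IsChain R := by
  rw [natSegment]
  generalize b - a = k
  induction k generalizing a with
  | zero => simp
  | succ k ih =>
    rw [List.range'_succ]
    cases k with
    | zero => simp
    | succ k =>
      have := ih (a + 1)
      rw [List.range'_succ] at this ⊢
      exact List.isChain_cons_cons.mpr ⟨h a, this⟩

theorem isChain_natSegment_reverse (hs : ∀ p q, R p q → R q p) (h : ∀ p, R p (p + 1)) (a b : ℕ) :
    (natSegment a b).reverse.IsChain R := by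
  rw [List.isChain_reverse]
  exact isChain_natSegment (R := fun a b => R b a) (fun p => hs _ _ (h p)) a b

theorem natSegment_head? {a b : ℕ} (h : a < b) : (natSegment a b).head? = some a := by
  rw [natSegment, List.head?_range', if_neg (by omega)]

theorem natSegment_getLast? {a b : ℕ} (h : a < b) : (natSegment a b).getLast? = some (b - 1) := by
  rw [natSegment, List.getLast?_range', if_neg (by omega)]
  congr 1
  omega

theorem natSegment_append {a b c : ℕ} (hab : a ≤ b) (hbc : b ≤ c) :
    natSegment a b ++ natSegment b c = natSegment a c := by
  have := List.range'_append (s := a) (m := b - a) (n := c - b) (step := 1)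
  rw [natSegment, natSegment, natSegment]
  rw [show a + 1 * (b - a) = b by omega, show b - a + (c - b) = c - a by omega] at this
  exact this

/-- The order is [s₁, s₂), then [s₂, s₃) and [s₀, s₁) backwards, then [s₃, s₄). Three chords buy a
path whose ends are the prescribed s₁ and s₄ - 1. -/
theorem exists_isChain_four_segments (hs : ∀ p q, R p q → R q p) (h : ∀ p, R p (p + 1))
    {s₀ s₁ s₂ s₃ s₄ : ℕ} (h₀ : s₀ < s₁) (h₁ : s₁ < s₂) (h₂ : s₂ < s₃) (h₃ : s₃ < s₄)
    (j₁ : R (s₂ - 1) (s₃ - 1)) (j₂ : R s₂ (s₁ - 1)) (j₃ : R s₀ s₃) :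
    ∃ l : List ℕ, l.Perm (natSegment s₀ s₄) ∧ l.IsChain R ∧ l.head? = some s₁ ∧
      l.getLast? = some (s₄ - 1) := by
  refine ⟨natSegment s₁ s₂ ++ ((natSegment s₂ s₃).reverse ++ ((natSegment s₀ s₁).reverse ++
    natSegment s₃ s₄)), ?_, ?_, ?_, ?_⟩
  · rw [← natSegment_append (a := s₀) (b := s₁) (c := s₄) (by omega) (by omega),
      ← natSegment_append (a := s₁) (b := s₂) (c := s₄) (by omega) (by omega),
      ← natSegment_append (a := s₂) (b := s₃) (c := s₄) (by omega) (by omega)]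
    refine List.perm_iff_count.mpr fun x => ?_
    simp only [List.count_append, List.count_reverse]
    omega
  · simp only [List.isChain_append, isChain_natSegment h, isChain_natSegment_reverse hs h,
      List.getLast?_reverse, List.head?_reverse, List.head?_append, natSegment_head?,
      natSegment_getLast?, h₀, h₁, h₂, h₃]
    simp [j₁, j₂, j₃]
  · simp [List.head?_append, natSegment_head?, h₁]
  · simp [List.getLast?_append, natSegment_getLast?, h₃]

/-- The order is [s₃, s₄), then [s₀, s₁) backwards, then [s₂, s₃), [s₁, s₂), [s₄, s₅). -/
theorem exists_isChain_five_segments (hs : ∀ p q, R p q → R q p) (h : ∀ p, R p (p + 1))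
    {s₀ s₁ s₂ s₃ s₄ s₅ : ℕ} (h₀ : s₀ < s₁) (h₁ : s₁ < s₂) (h₂ : s₂ < s₃) (h₃ : s₃ < s₄)
    (h₄ : s₄ < s₅) (j₁ : R (s₄ - 1) (s₁ - 1)) (j₂ : R s₀ s₂) (j₃ : R (s₃ - 1) s₁)
    (j₄ : R (s₂ - 1) s₄) :
    ∃ l : List ℕ, l.Perm (natSegment s₀ s₅) ∧ l.IsChain R ∧ l.head? = some s₃ ∧
      l.getLast? = some (s₅ - 1) := by
  refine ⟨natSegment s₃ s₄ ++ ((natSegment s₀ s₁).reverse ++ (natSegment s₂ s₃ ++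
    (natSegment s₁ s₂ ++ natSegment s₄ s₅))), ?_, ?_, ?_, ?_⟩
  · rw [← natSegment_append (a := s₀) (b := s₁) (c := s₅) (by omega) (by omega),
      ← natSegment_append (a := s₁) (b := s₂) (c := s₅) (by omega) (by omega),
      ← natSegment_append (a := s₂) (b := s₃) (c := s₅) (by omega) (by omega),
      ← natSegment_append (a := s₃) (b := s₄) (c := s₅) (by omega) (by omega)]
    refine List.perm_iff_count.mpr fun x => ?_
    simp only [List.count_append, List.count_reverse]
    omega
  · simp only [List.isChain_append, isChain_natSegment h, isChain_natSegment_reverse hs h,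
      List.getLast?_reverse, List.head?_reverse, List.head?_append, natSegment_head?,
      natSegment_getLast?, h₀, h₁, h₂, h₃, h₄]
    simp [j₁, j₂, j₃, j₄]
  · simp [List.head?_append, natSegment_head?, h₃]
  · simp [List.getLast?_append, natSegment_getLast?, h₄]

end Segments

theorem card_inter_eq_two {α : Type*} [DecidableEq α] {A B : Finset α} (hA : A.card = 3)
    {P Q X : α} (hPQ : P ≠ Q) (hPA : P ∈ A) (hQA : Q ∈ A) (hPB : P ∈ B) (hQB : Q ∈ B)
    (hXA : X ∈ A) (hXB : X ∉ B) : (A ∩ B).card = 2 := by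
  have h1 : ({P, Q} : Finset α) ⊆ A ∩ B := by
    intro y hy
    rw [Finset.mem_insert, Finset.mem_singleton] at hy
    rcases hy with rfl | rfl <;> simp [*]
  have h2 : A ∩ B ⊂ A := by
    refine ⟨Finset.inter_subset_left, fun h => hXB ?_⟩
    exact (Finset.mem_inter.mp (h hXA)).2
  have h3 := Finset.card_le_card h1
  have h4 := Finset.card_lt_card h2
  rw [Finset.card_pair hPQ] at h3
  omega

/-! ### 1-rotational systems on ℤ/N ∪ {∞} -/

section Rotational

variable {N : ℕ}

/-- The translate of a set of residues by `s`. -/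
def residueTranslate (A : Finset (ZMod N)) (s : ZMod N) : Finset (ZMod N) :=
  A.map (addRightEmbedding s)

theorem mem_residueTranslate {A : Finset (ZMod N)} {s y : ZMod N} :
    y ∈ residueTranslate A s ↔ y - s ∈ A := by
  simp only [residueTranslate, Finset.mem_map, addRightEmbedding_apply]
  constructor
  · rintro ⟨a, ha, rfl⟩
    simpa using ha
  · intro h
    exact ⟨_, h, by simp⟩

theorem card_residueTranslate (A : Finset (ZMod N)) (s : ZMod N) :
    (residueTranslate A s).card = A.card :=
  Finset.card_map _

/-- The blocks of a 1-rotational system: the translates of the base blocks `B k` with `k < n`,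
and the translates of `{∞, 0, d}`. -/
def rotationalBlock {n : ℕ} (B : ℕ → Finset (ZMod N)) (d : ZMod N) :
    (Fin n × ZMod N) ⊕ ZMod N → Finset (Option (ZMod N))
  | Sum.inl ks => (residueTranslate (B ks.1) ks.2).map Function.Embedding.some
  | Sum.inr j => {none, some j, some (j + d)}

/-- Division with remainder by `n` turns a natural number into a translate of a base block, where
each full round of the `n` base blocks translates by `c`. -/
def positionBlock (n : ℕ) (B : ℕ → Finset (ZMod N)) (c : ZMod N) (p : ℕ) : Finset (ZMod N) :=
  residueTranslate (B (p % n)) (c * (p / n : ℕ))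

variable {n : ℕ} {B : ℕ → Finset (ZMod N)} {c c' d : ZMod N}

/-- A pair {z, z + g} lies in a suitable translate of each triple having the difference g; two such
triples are distinct because their base indices differ or one of them contains ∞. The pair {∞, z}
lies in the infinite triples that start at z and at z - d. -/
theorem exists_two_rotationalBlock [NeZero N] (hd : 2 * d ≠ 0)
    (hcov : ∀ g : ℕ, 1 ≤ g → 2 * g ≤ N →
      ((g : ZMod N) = d ∧ ∃ k < n, ∃ a ∈ B k, a + g ∈ B k) ∨
      ∃ k < n, ∃ k' < n, k ≠ k' ∧ (∃ a ∈ B k, a + g ∈ B k) ∧ ∃ a ∈ B k', a + g ∈ B k')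
    (x y : Option (ZMod N)) (hxy : x ≠ y) :
    ∃ i j, i ≠ j ∧ x ∈ rotationalBlock (n := n) B d i ∧ y ∈ rotationalBlock (n := n) B d i ∧
      x ∈ rotationalBlock (n := n) B d j ∧ y ∈ rotationalBlock (n := n) B d j := by
  have hd0 : d ≠ 0 := by
    rintro rfl
    simp at hd
  have hinf : ∀ z : ZMod N, ∃ i j, i ≠ j ∧ none ∈ rotationalBlock (n := n) B d i ∧
      some z ∈ rotationalBlock (n := n) B d i ∧
      none ∈ rotationalBlock (n := n) B d j ∧ some z ∈ rotationalBlock (n := n) B d j := by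
    intro z
    refine ⟨Sum.inr z, Sum.inr (z - d), ?_, ?_⟩
    · intro h
      have h' := Sum.inr_injective h
      exact hd0 (by linear_combination h')
    · simp [rotationalBlock]
  have key : ∀ (z : ZMod N) (g : ℕ), 1 ≤ g → 2 * g ≤ N → ∃ i j, i ≠ j ∧
      some z ∈ rotationalBlock (n := n) B d i ∧ some (z + g) ∈ rotationalBlock (n := n) B d i ∧
      some z ∈ rotationalBlock (n := n) B d j ∧
        some (z + g) ∈ rotationalBlock (n := n) B d j := by
    intro z g h1 h2
    have hmem : ∀ k (hk : k < n), ∀ a ∈ B k, a + g ∈ B k →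
        some z ∈ rotationalBlock (n := n) B d (Sum.inl (⟨k, hk⟩, z - a)) ∧
        some (z + g) ∈ rotationalBlock (n := n) B d (Sum.inl (⟨k, hk⟩, z - a)) := by
      intro k hk a ha hag
      simp only [rotationalBlock, Finset.mem_map, Function.Embedding.some_apply, Option.some.injEq,
        exists_eq_right, mem_residueTranslate]
      refine ⟨by simpa using ha, ?_⟩
      convert hag using 1
      ring
    rcases hcov g h1 h2 with ⟨hg, k, hk, a, ha, hag⟩ | ⟨k, hk, k', hk', hne, ⟨a, ha, hag⟩, a', ha', hag'⟩
    · refine ⟨Sum.inr z, _, ?_, ?_, ?_, (hmem k hk a ha hag).1, (hmem k hk a ha hag).2⟩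
      · simp
      · simp [rotationalBlock]
      · simp [rotationalBlock, hg]
    · refine ⟨_, _, ?_, (hmem k hk a ha hag).1, (hmem k hk a ha hag).2, (hmem k' hk' a' ha' hag').1,
        (hmem k' hk' a' ha' hag').2⟩
      intro h
      simp only [Sum.inl.injEq, Prod.mk.injEq, Fin.mk.injEq] at h
      exact hne h.1
  have key' : ∀ z w : ZMod N, z ≠ w → ∃ i j, i ≠ j ∧
      some z ∈ rotationalBlock (n := n) B d i ∧ some w ∈ rotationalBlock (n := n) B d i ∧
      some z ∈ rotationalBlock (n := n) B d j ∧ some w ∈ rotationalBlock (n := n) B d j := by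
    intro z w hzw
    have hval : ((w - z).val : ZMod N) = w - z := ZMod.natCast_zmod_val _
    have hlt : (w - z).val < N := ZMod.val_lt _
    have hpos : 1 ≤ (w - z).val := by
      rw [Nat.one_le_iff_ne_zero, Ne, ZMod.val_eq_zero, sub_eq_zero]
      exact hzw.symm
    by_cases h : 2 * (w - z).val ≤ N
    · have := key z _ hpos h
      rwa [hval, add_sub_cancel] at this
    -- A difference above N/2 is replaced by its negative, with the two points exchanged.
    · obtain ⟨i, j, hij, h1, h2, h3, h4⟩ := key w (N - (w - z).val) (by omega) (by omega)
      have hz : w + ((N - (w - z).val : ℕ) : ZMod N) = z := by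
        rw [Nat.cast_sub hlt.le, hval, ZMod.natCast_self]
        ring
      rw [hz] at h2 h4
      exact ⟨i, j, hij, h2, h1, h4, h3⟩
  rcases x with _ | x <;> rcases y with _ | y
  · exact absurd rfl hxy
  · exact hinf y
  · obtain ⟨i, j, hij, h1, h2, h3, h4⟩ := hinf x
    exact ⟨i, j, hij, h2, h1, h4, h3⟩
  · exact key' x y (by simpa using hxy)

/-- A 1-rotational twofold triple system, together with a Hamiltonian path through the translates
of its base blocks whose ends are adjacent to suitable blocks at infinity. -/
theorem exists_tts_of_rotational [NeZero N] (hn : 0 < n) (hNn : 3 * (n + 1) = N + 1)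
    (hB : ∀ k < n, (B k).card = 3) (hc : c * c' = 1) (hd : IsUnit d) (hd2 : 2 * d ≠ 0)
    (hcov : ∀ g : ℕ, 1 ≤ g → 2 * g ≤ N →
      ((g : ZMod N) = d ∧ ∃ k < n, ∃ a ∈ B k, a + g ∈ B k) ∨
      ∃ k < n, ∃ k' < n, k ≠ k' ∧ (∃ a ∈ B k, a + g ∈ B k) ∧ ∃ a ∈ B k', a + g ∈ B k')
    {l : List ℕ} {s p₀ p₁ : ℕ} (hperm : l.Perm (natSegment s (s + n * N)))
    (hchain : l.IsChain fun p q => (positionBlock n B c p ∩ positionBlock n B c q).card = 2)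
    (hhead : l.head? = some p₀) (hlast : l.getLast? = some p₁) (j₀ : ZMod N)
    (h₁ : j₀ ∈ positionBlock n B c p₁) (h₁' : j₀ + d ∈ positionBlock n B c p₁)
    (h₀ : j₀ + d ∈ positionBlock n B c p₀) (h₀' : j₀ + d + d ∈ positionBlock n B c p₀) :
    ∃ D : TTS (Fin (N + 1)) (N + 1), (D.blockIntersectionGraph 2).IsHamiltonian := by
  have hN : 3 ≤ N := by
    have : N ≠ 0 := NeZero.ne N
    omega
  have hd0 : d ≠ 0 := by
    rintro rfl
    simp at hd2
  let v : ℕ → (Fin n × ZMod N) ⊕ ZMod N := fun p =>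
    Sum.inl (⟨p % n, Nat.mod_lt _ hn⟩, c * (p / n : ℕ))
  -- Steps of -d start at j₀ and end, for i = N - 1, at j₀ + d, so these two infinite triples meet
  -- the ends of `l`.
  let e : ℕ → (Fin n × ZMod N) ⊕ ZMod N := fun i => Sum.inr (j₀ - i * d)
  have hv : ∀ p, rotationalBlock B d (v p) =
      (positionBlock n B c p).map Function.Embedding.some := fun p => rfl
  have hcan : ∀ a b : ℕ, c * (a : ZMod N) = c * b → a % N = b % N := by
    intro a b h
    rw [← ZMod.natCast_eq_natCast_iff']
    calc (a : ZMod N) = c * c' * a := by rw [hc, one_mul]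
      _ = c' * (c * a) := by ring
      _ = c' * (c * b) := by rw [h]
      _ = c * c' * b := by ring
      _ = b := by rw [hc, one_mul]
  have hvinj : ∀ p ∈ l, ∀ q ∈ l, v p = v q → p = q := by
    intro p hp q hq h
    have hp' := hperm.mem_iff.mp hp
    have hq' := hperm.mem_iff.mp hq
    simp only [natSegment, List.mem_range'_1] at hp' hq'
    simp only [v, Sum.inl.injEq, Prod.mk.injEq, Fin.mk.injEq] at h
    obtain ⟨hm, hq2⟩ := h
    have hdiv := hcan _ _ hq2
    -- Since c is a unit, the vertex determines p modulo n * N, and `l` lies in a window of exactly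
    -- that length.
    have hmod : p ≡ q [MOD n * N] := by
      rw [Nat.ModEq, Nat.mod_mul, Nat.mod_mul, hm, hdiv]
    wlog hpq : p ≤ q generalizing p q
    · exact (this q hq p hp hq' hp' hm.symm hq2.symm hdiv.symm hmod.symm (by omega)).symm
    obtain ⟨t, ht⟩ := (Nat.modEq_iff_dvd' hpq).mp hmod
    rcases Nat.eq_zero_or_pos t with rfl | htpos
    · omega
    · have : n * N ≤ n * N * t := Nat.le_mul_of_pos_right _ htpos
      omega
  have heinj : ∀ a ∈ List.range N, ∀ b ∈ List.range N, e a = e b → a = b := by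
    intro a ha b hb h
    simp only [List.mem_range] at ha hb
    simp only [e, Sum.inr.injEq, sub_right_inj] at h
    have h2 := hd.mul_right_cancel h
    rw [ZMod.natCast_eq_natCast_iff', Nat.mod_eq_of_lt ha, Nat.mod_eq_of_lt hb] at h2
    exact h2
  have hlnd : l.Nodup := hperm.nodup_iff.mpr List.nodup_range'
  have hllen : l.length = n * N := by
    rw [hperm.length_eq, natSegment, List.length_range']
    omega
  set L := l.map v ++ (List.range N).map e with hL
  have hLnd : L.Nodup := by
    rw [hL, List.nodup_append]
    refine ⟨hlnd.map_on hvinj, List.nodup_range.map_on heinj, ?_⟩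
    intro a ha b hb
    obtain ⟨p, -, rfl⟩ := List.mem_map.mp ha
    obtain ⟨i, -, rfl⟩ := List.mem_map.mp hb
    simp [v, e]
  have hLlen : L.length = n * N + N := by
    rw [hL, List.length_append, List.length_map, List.length_map, hllen, List.length_range]
  have hcardι : Fintype.card ((Fin n × ZMod N) ⊕ ZMod N) = n * N + N := by
    simp [ZMod.card]
  have hLmem : ∀ a, a ∈ L := by
    intro a
    have : L.toFinset = Finset.univ := by
      rw [← Finset.card_eq_iff_eq_univ, List.toFinset_card_of_nodup hLnd, hLlen, hcardι]
    rw [← List.mem_toFinset, this]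
    exact Finset.mem_univ a
  have hLne : L ≠ [] := List.ne_nil_of_length_pos (by rw [hLlen]; omega)
  have hcard : ∀ i, (rotationalBlock (n := n) B d i).card = 3 := by
    rintro (⟨k, s⟩ | j)
    · simp only [rotationalBlock, Finset.card_map, card_residueTranslate]
      exact hB k k.2
    · rw [rotationalBlock, Finset.card_eq_three]
      exact ⟨none, some j, some (j + d), by simp, by simp, by simpa using hd0, rfl⟩
  have hve : ∀ (p : ℕ) (j : ZMod N), j ∈ positionBlock n B c p → j + d ∈ positionBlock n B c p →
      (rotationalBlock (n := n) B d (Sum.inr j) ∩ rotationalBlock B d (v p)).card = 2 := by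
    intro p j h1 h2
    refine card_inter_eq_two (hcard _) (P := some j) (Q := some (j + d)) (X := none)
      (by simpa using hd0) ?_ ?_ ?_ ?_ ?_ ?_
    · simp [rotationalBlock]
    · simp [rotationalBlock]
    · rw [hv]
      simpa using h1
    · rw [hv]
      simpa using h2
    · simp [rotationalBlock]
    · rw [hv]
      simp
  have he0 : e 0 = Sum.inr j₀ := by simp [e]
  have heN : e (N - 1) = Sum.inr (j₀ + d) := by
    simp only [e, Nat.cast_sub (show 1 ≤ N by omega), ZMod.natCast_self]
    congr 1
    push_cast
    ring
  refine exists_tts_of_blocks (v := N + 1) (by simp [ZMod.card]) (rotationalBlock (n := n) B d)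
    hcard (exists_two_rotationalBlock hd2 hcov) ?_ L hLne hLnd hLmem (by rw [hLlen]; omega) ?_ ?_
  · rw [hcardι, Nat.add_sub_cancel, ← hNn]
    ring
  · rw [hL, List.isChain_append]
    refine ⟨?_, ?_, ?_⟩
    · rw [List.isChain_map]
      refine hchain.imp fun p q h => ?_
      rw [hv, hv, ← Finset.map_inter, Finset.card_map]
      exact h
    · rw [List.isChain_map, List.isChain_range]
      intro i _
      refine card_inter_eq_two (hcard _) (P := none) (Q := some (j₀ - i * d))
        (X := some (j₀ - i * d + d)) (by simp) ?_ ?_ ?_ ?_ ?_ ?_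
      · simp [rotationalBlock, e]
      · simp [rotationalBlock, e]
      · simp [rotationalBlock, e]
      · simp only [rotationalBlock, e, Finset.mem_insert, Finset.mem_singleton, Option.some.injEq]
        right; right
        push_cast
        ring
      · simp [rotationalBlock, e]
      · simp only [rotationalBlock, e, Finset.mem_insert, Finset.mem_singleton, Option.some.injEq,
          reduceCtorEq, false_or, not_or]
        -- With 2d = 0 the triples starting at j and j - d would coincide.
        refine ⟨fun h => hd2 ?_, fun h => hd0 ?_⟩
        · push_cast at h
          linear_combination h
        · push_cast at h
          linear_combination h
    · intro x hx y hy
      rw [List.getLast?_map, hlast] at hx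
      rw [List.head?_map, List.head?_range, if_neg (by omega)] at hy
      simp only [Option.map_some, Option.mem_def, Option.some.injEq] at hx hy
      subst hx hy
      rw [Finset.inter_comm, he0]
      exact hve p₁ j₀ h₁ h₁'
  · have hhd : L.head hLne = v p₀ := by
      apply Option.some_injective
      rw [← List.head?_eq_some_head, hL, List.head?_append, List.head?_map, hhead]
      rfl
    have hlt : L.getLast hLne = e (N - 1) := by
      apply Option.some_injective
      rw [← List.getLast?_eq_some_getLast, hL, List.getLast?_append, List.getLast?_map,
        List.getLast?_range, if_neg (by omega)]
      rfl
    rw [hhd, hlt, heN]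
    exact hve p₀ _ h₀ h₀'

end Rotational

/-! ### Base triples with natural representatives -/

section Triples

variable {N n : ℕ} {B : ℕ → Finset (ZMod N)} {c : ZMod N}

theorem card_residueTranslate_inter (A A' : Finset (ZMod N)) (s s' : ZMod N) :
    (residueTranslate A s ∩ residueTranslate A' s').card =
      (A ∩ residueTranslate A' (s' - s)).card := by
  rw [← card_residueTranslate (A ∩ residueTranslate A' (s' - s)) s]
  congr 1
  ext y
  simp only [Finset.mem_inter, mem_residueTranslate]
  rw [show y - s - (s' - s) = y - s' by ring]

theorem positionBlock_mul_add {k : ℕ} (hk : k < n) (t : ℕ) :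
    positionBlock n B c (n * t + k) = residueTranslate (B k) (c * t) := by
  rw [positionBlock, Nat.mul_add_mod, Nat.mod_eq_of_lt hk, Nat.mul_add_div (by omega),
    Nat.div_eq_of_lt hk, add_zero]

/-- Within a round both triples have the same translate, which cancels. Between rounds the last base
triple meets the first one shifted by one more c. -/
theorem card_positionBlock_inter_succ (hn : 0 < n)
    (h : ∀ k, k + 1 < n → (B k ∩ B (k + 1)).card = 2)
    (h' : (B (n - 1) ∩ residueTranslate (B 0) c).card = 2) (p : ℕ) :
    (positionBlock n B c p ∩ positionBlock n B c (p + 1)).card = 2 := by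
  have hp : p = n * (p / n) + p % n := (Nat.div_add_mod p n).symm
  generalize p / n = t at hp
  have hlt : p % n < n := Nat.mod_lt _ hn
  generalize p % n = k at hp hlt
  subst hp
  rw [positionBlock_mul_add hlt]
  by_cases hk : k + 1 < n
  · rw [add_assoc, positionBlock_mul_add hk, card_residueTranslate_inter, sub_self, ← h k hk]
    congr 2
    ext y
    simp [mem_residueTranslate]
  · have hk' : k = n - 1 := by omega
    rw [show n * t + k + 1 = n * (t + 1) + 0 by rw [mul_add, mul_one]; omega,
      positionBlock_mul_add hn, card_residueTranslate_inter, hk', ← h']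
    congr 3
    push_cast
    ring

/-- This supplies the chords: adjacency depends only on the relative shift σ of the two rounds. -/
theorem card_positionBlock_inter {k k' t t' : ℕ} (hk : k < n) (hk' : k' < n) (σ : ZMod N)
    (hσ : c * t' = c * t + σ) (h : (B k ∩ residueTranslate (B k') σ).card = 2) :
    (positionBlock n B c (n * t + k) ∩ positionBlock n B c (n * t' + k')).card = 2 := by
  rw [positionBlock_mul_add hk, positionBlock_mul_add hk', card_residueTranslate_inter, ← h, hσ,
    add_sub_cancel_left]

/-- The residues of three natural numbers. -/
def residueTriple (N : ℕ) (t : ℕ × ℕ × ℕ) : Finset (ZMod N) :=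
  {(t.1 : ZMod N), (t.2.1 : ZMod N), (t.2.2 : ZMod N)}

/-- `x` is an entry of the triple `t`. -/
def IsEntry (x : ℕ) (t : ℕ × ℕ × ℕ) : Prop :=
  x = t.1 ∨ x = t.2.1 ∨ x = t.2.2

/-- The entries of `t` are distinct and less than `N`. -/
def IsProperTriple (N : ℕ) (t : ℕ × ℕ × ℕ) : Prop :=
  t.1 < N ∧ t.2.1 < N ∧ t.2.2 < N ∧ t.1 ≠ t.2.1 ∧ t.1 ≠ t.2.2 ∧ t.2.1 ≠ t.2.2

/-- Representatives below N turn equality of residues into equality in ℕ, which `omega` can decide.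
-/
theorem natCast_residue_inj {a b : ℕ} (ha : a < N) (hb : b < N) :
    (a : ZMod N) = b ↔ a = b := by
  rw [ZMod.natCast_eq_natCast_iff', Nat.mod_eq_of_lt ha, Nat.mod_eq_of_lt hb]

theorem IsEntry.mem {x : ℕ} {t : ℕ × ℕ × ℕ} (h : IsEntry x t) :
    (x : ZMod N) ∈ residueTriple N t := by
  rcases h with rfl | rfl | rfl <;> simp [residueTriple]

theorem IsProperTriple.card {t : ℕ × ℕ × ℕ} (h : IsProperTriple N t) : (residueTriple N t).card = 3 := by
  obtain ⟨h1, h2, h3, h12, h13, h23⟩ := h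
  rw [residueTriple, Finset.card_eq_three]
  exact ⟨_, _, _, by rwa [Ne, natCast_residue_inj h1 h2], by rwa [Ne, natCast_residue_inj h1 h3],
    by rwa [Ne, natCast_residue_inj h2 h3], rfl⟩

theorem IsProperTriple.isEntry_of_mem {t : ℕ × ℕ × ℕ} (h : IsProperTriple N t) {x : ℕ} (hx : x < N)
    (hm : (x : ZMod N) ∈ residueTriple N t) : IsEntry x t := by
  obtain ⟨h1, h2, h3, -⟩ := h
  simpa [residueTriple, IsEntry, natCast_residue_inj, hx, h1, h2, h3] using hm

theorem IsProperTriple.lt_of_isEntry {t : ℕ × ℕ × ℕ} (h : IsProperTriple N t) {x : ℕ} (hx : IsEntry x t) :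
    x < N := by
  obtain ⟨h1, h2, h3, -⟩ := h
  rcases hx with rfl | rfl | rfl <;> assumption

theorem card_residueTriple_inter {t t' : ℕ × ℕ × ℕ} (ht : IsProperTriple N t) (ht' : IsProperTriple N t')
    (P Q X : ℕ) (hPQ : P ≠ Q) (hP : IsEntry P t) (hQ : IsEntry Q t) (hP' : IsEntry P t')
    (hQ' : IsEntry Q t') (hX : IsEntry X t) (hX' : ¬ IsEntry X t') :
    (residueTriple N t ∩ residueTriple N t').card = 2 := by
  refine card_inter_eq_two ht.card (P := (P : ZMod N)) (Q := (Q : ZMod N)) (X := (X : ZMod N))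
    ?_ hP.mem hQ.mem hP'.mem hQ'.mem hX.mem ?_
  · rwa [Ne, natCast_residue_inj (ht.lt_of_isEntry hP) (ht.lt_of_isEntry hQ)]
  · exact fun h => hX' (ht'.isEntry_of_mem (ht.lt_of_isEntry hX) h)

theorem residueTranslate_residueTriple {t t' : ℕ × ℕ × ℕ} {s : ZMod N}
    (h₁ : (t.1 : ZMod N) + s = t'.1) (h₂ : (t.2.1 : ZMod N) + s = t'.2.1)
    (h₃ : (t.2.2 : ZMod N) + s = t'.2.2) :
    residueTranslate (residueTriple N t) s = residueTriple N t' := by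
  ext y
  rw [mem_residueTranslate]
  simp only [residueTriple, Finset.mem_insert, Finset.mem_singleton, ← h₁, ← h₂, ← h₃,
    sub_eq_iff_eq_add]

/-- The difference `g` modulo `N` occurs between two entries of `t`. -/
def HasDifference (N : ℕ) (t : ℕ × ℕ × ℕ) (g : ℕ) : Prop :=
  ∃ x y, IsEntry x t ∧ IsEntry y t ∧ (x + g = y ∨ y + g = x ∨ x + g = y + N)

theorem HasDifference.exists_mem {t : ℕ × ℕ × ℕ} {g : ℕ} (h : HasDifference N t g) :
    ∃ a ∈ residueTriple N t, a + (g : ZMod N) ∈ residueTriple N t := by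
  obtain ⟨x, y, hx, hy, h | h | h⟩ := h
  · refine ⟨x, hx.mem, ?_⟩
    rw [← Nat.cast_add, h]
    exact hy.mem
  · refine ⟨y, hy.mem, ?_⟩
    rw [← Nat.cast_add, h]
    exact hx.mem
  · refine ⟨x, hx.mem, ?_⟩
    rw [← Nat.cast_add, h, Nat.cast_add, ZMod.natCast_self, add_zero]
    exact hy.mem

end Triples

/-- The zigzag sequence `2m, m + 1, 2m - 1, m + 2, …`. -/
def zigzag (m k : ℕ) : ℕ :=
  if k % 2 = 0 then 2 * m - k / 2 else m + 1 + k / 2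

/-! ### The modulus 12u + 23 -/

section EvenCase

/-- The sequence `5u + 11, 5u + 9, 5u + 12, 5u + 8, …`. -/
def evenTail (u j : ℕ) : ℕ :=
  if j % 2 = 0 then 5 * u + 11 + j / 2 else 5 * u + 9 - j / 2

/-- The base blocks modulo `12u + 23`. -/
def evenBase (u k : ℕ) : ℕ × ℕ × ℕ :=
  if k < 2 * u + 2 then (0, zigzag (2 * u + 4) k, zigzag (2 * u + 4) (k + 1))
  else if k = 2 * u + 2 then (0, 1, 3 * u + 7)
  else if k = 2 * u + 3 then (1, 3 * u + 7, 5 * u + 11)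
  else if k = 2 * u + 4 then (1, 5 * u + 11, 10 * u + 20)
  else (10 * u + 20, evenTail u (k - (2 * u + 5)), evenTail u (k - (2 * u + 5) + 1))

variable {u : ℕ}

theorem evenBase_zigzag {k : ℕ} (hk : k < 2 * u + 2) :
    evenBase u k = (0, zigzag (2 * u + 4) k, zigzag (2 * u + 4) (k + 1)) := by
  rw [evenBase, if_pos hk]

theorem evenBase_T : evenBase u (2 * u + 2) = (0, 1, 3 * u + 7) := by
  simp [evenBase]

theorem evenBase_C : evenBase u (2 * u + 3) = (1, 3 * u + 7, 5 * u + 11) := by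
  simp [evenBase]

theorem evenBase_S : evenBase u (2 * u + 4) = (1, 5 * u + 11, 10 * u + 20) := by
  simp [evenBase]

theorem evenBase_tail (j : ℕ) :
    evenBase u (2 * u + 5 + j) = (10 * u + 20, evenTail u j, evenTail u (j + 1)) := by
  rw [evenBase, if_neg (by omega), if_neg (by omega), if_neg (by omega), if_neg (by omega),
    Nat.add_sub_cancel_left]

theorem even_index_cases {k : ℕ} (hk : k < 4 * u + 7) :
    k < 2 * u + 2 ∨ k = 2 * u + 2 ∨ k = 2 * u + 3 ∨ k = 2 * u + 4 ∨
      ∃ j, j < 2 * u + 2 ∧ k = 2 * u + 5 + j := by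
  by_cases h : 2 * u + 5 ≤ k
  · exact Or.inr (Or.inr (Or.inr (Or.inr ⟨k - (2 * u + 5), by omega, by omega⟩)))
  · omega

theorem isProperTriple_evenBase {k : ℕ} (hk : k < 4 * u + 7) :
    IsProperTriple (12 * u + 23) (evenBase u k) := by
  rcases even_index_cases hk with h | rfl | rfl | rfl | ⟨j, hj, rfl⟩
  · rw [evenBase_zigzag h]
    simp only [IsProperTriple, zigzag]
    split_ifs <;> omega
  · rw [evenBase_T]
    simp only [IsProperTriple]
    omega
  · rw [evenBase_C]
    simp only [IsProperTriple]
    omega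
  · rw [evenBase_S]
    simp only [IsProperTriple]
    omega
  · rw [evenBase_tail]
    simp only [IsProperTriple, evenTail]
    split_ifs <;> omega

theorem card_evenBase_inter_succ {k : ℕ} (hk : k + 1 < 4 * u + 7) :
    (residueTriple (12 * u + 23) (evenBase u k) ∩
      residueTriple (12 * u + 23) (evenBase u (k + 1))).card = 2 := by
  have h₀ := isProperTriple_evenBase (u := u) (k := k) (by omega)
  have h₁ := isProperTriple_evenBase (u := u) (k := k + 1) hk
  rcases even_index_cases (u := u) (k := k) (by omega) with h | rfl | rfl | rfl | ⟨j, hj, rfl⟩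
  · by_cases h' : k + 1 < 2 * u + 2
    · rw [evenBase_zigzag h] at h₀ ⊢
      rw [evenBase_zigzag h'] at h₁ ⊢
      refine card_residueTriple_inter h₀ h₁ 0 (zigzag (2 * u + 4) (k + 1))
        (zigzag (2 * u + 4) k) ?_ (Or.inl rfl) (Or.inr (Or.inr rfl)) (Or.inl rfl)
        (Or.inr (Or.inl rfl)) (Or.inr (Or.inl rfl)) ?_
      all_goals
        simp only [IsEntry, zigzag]
        split_ifs <;> omega
    · obtain rfl : k = 2 * u + 1 := by omega
      rw [evenBase_zigzag h] at h₀ ⊢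
      rw [show 2 * u + 1 + 1 = 2 * u + 2 by rfl, evenBase_T] at h₁ ⊢
      refine card_residueTriple_inter h₀ h₁ 0 (3 * u + 7) (zigzag (2 * u + 4) (2 * u + 1))
        (by omega) (Or.inl rfl) (Or.inr (Or.inr ?_)) (Or.inl rfl) (Or.inr (Or.inr rfl))
        (Or.inr (Or.inl rfl)) ?_
      all_goals
        simp only [IsEntry, zigzag]
        split_ifs <;> omega
  · rw [evenBase_T] at h₀ ⊢
    rw [show 2 * u + 2 + 1 = 2 * u + 3 by rfl, evenBase_C] at h₁ ⊢
    refine card_residueTriple_inter h₀ h₁ 1 (3 * u + 7) 0 ?_ ?_ ?_ ?_ ?_ ?_ ?_ <;>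
      simp [IsEntry]
  · rw [evenBase_C] at h₀ ⊢
    rw [show 2 * u + 3 + 1 = 2 * u + 4 by rfl, evenBase_S] at h₁ ⊢
    refine card_residueTriple_inter h₀ h₁ 1 (5 * u + 11) (3 * u + 7) ?_ ?_ ?_ ?_ ?_ ?_ ?_ <;>
      simp [IsEntry] <;> omega
  · rw [evenBase_S] at h₀ ⊢
    rw [show 2 * u + 4 + 1 = 2 * u + 5 + 0 by rfl, evenBase_tail] at h₁ ⊢
    refine card_residueTriple_inter h₀ h₁ (5 * u + 11) (10 * u + 20) 1 ?_ ?_ ?_ ?_ ?_ ?_ ?_ <;>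
      simp [IsEntry, evenTail] <;> omega
  · rw [evenBase_tail] at h₀ ⊢
    rw [add_assoc (2 * u + 5) j 1, evenBase_tail] at h₁ ⊢
    refine card_residueTriple_inter h₀ h₁ (10 * u + 20) (evenTail u (j + 1)) (evenTail u j)
      ?_ (Or.inl rfl) (Or.inr (Or.inr rfl)) (Or.inl rfl)
        (Or.inr (Or.inl rfl)) (Or.inr (Or.inl rfl)) ?_
    all_goals
      simp only [IsEntry, evenTail]
      split_ifs <;> omega

/-- Consecutive zigzag terms differ by 2u + 3, …, 2 in the fan at 0 and by 2, …, 2u + 3 in the tail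
fan. An inner zigzag term gives its distance to the apex to two consecutive triples. The distances
at the fan ends and those of the three connecting triples pair up, except that the difference 1
occurs only in {0, 1, 3u + 7}; hence d = 1. -/
theorem evenBase_hasDifference {g : ℕ} (h1 : 1 ≤ g) (h2 : 2 * g ≤ 12 * u + 23) :
    (g = 1 ∧ ∃ k < 4 * u + 7, HasDifference (12 * u + 23) (evenBase u k) g) ∨
    ∃ k < 4 * u + 7, ∃ k' < 4 * u + 7, k ≠ k' ∧
      HasDifference (12 * u + 23) (evenBase u k) g ∧
      HasDifference (12 * u + 23) (evenBase u k') g := by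
  have hz : ∀ k, k < 2 * u + 2 → ∀ x y, (x = 0 ∨ x = zigzag (2 * u + 4) k ∨
      x = zigzag (2 * u + 4) (k + 1)) → (y = 0 ∨ y = zigzag (2 * u + 4) k ∨
      y = zigzag (2 * u + 4) (k + 1)) → (x + g = y ∨ y + g = x ∨ x + g = y + (12 * u + 23)) →
      HasDifference (12 * u + 23) (evenBase u k) g := by
    intro k hk x y hx hy h
    rw [evenBase_zigzag hk]
    exact ⟨x, y, hx, hy, h⟩
  have ht : ∀ j, ∀ x y, (x = 10 * u + 20 ∨ x = evenTail u j ∨ x = evenTail u (j + 1)) →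
      (y = 10 * u + 20 ∨ y = evenTail u j ∨ y = evenTail u (j + 1)) →
      (x + g = y ∨ y + g = x ∨ x + g = y + (12 * u + 23)) →
      HasDifference (12 * u + 23) (evenBase u (2 * u + 5 + j)) g := by
    intro j x y hx hy h
    rw [evenBase_tail]
    exact ⟨x, y, hx, hy, h⟩
  have hT : ∀ x y, (x = 0 ∨ x = 1 ∨ x = 3 * u + 7) → (y = 0 ∨ y = 1 ∨ y = 3 * u + 7) →
      (x + g = y ∨ y + g = x ∨ x + g = y + (12 * u + 23)) →
      HasDifference (12 * u + 23) (evenBase u (2 * u + 2)) g := by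
    intro x y hx hy h
    rw [evenBase_T]
    exact ⟨x, y, hx, hy, h⟩
  have hC : ∀ x y, (x = 1 ∨ x = 3 * u + 7 ∨ x = 5 * u + 11) →
      (y = 1 ∨ y = 3 * u + 7 ∨ y = 5 * u + 11) →
      (x + g = y ∨ y + g = x ∨ x + g = y + (12 * u + 23)) →
      HasDifference (12 * u + 23) (evenBase u (2 * u + 3)) g := by
    intro x y hx hy h
    rw [evenBase_C]
    exact ⟨x, y, hx, hy, h⟩
  have hS : ∀ x y, (x = 1 ∨ x = 5 * u + 11 ∨ x = 10 * u + 20) →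
      (y = 1 ∨ y = 5 * u + 11 ∨ y = 10 * u + 20) →
      (x + g = y ∨ y + g = x ∨ x + g = y + (12 * u + 23)) →
      HasDifference (12 * u + 23) (evenBase u (2 * u + 4)) g := by
    intro x y hx hy h
    rw [evenBase_S]
    exact ⟨x, y, hx, hy, h⟩
  rcases (by omega : g = 1 ∨ (2 ≤ g ∧ g ≤ 2 * u + 3) ∨ g = 2 * u + 4 ∨
      (2 * u + 5 ≤ g ∧ g ≤ 3 * u + 5) ∨ g = 3 * u + 6 ∨ g = 3 * u + 7 ∨
      (3 * u + 8 ≤ g ∧ g ≤ 4 * u + 7) ∨ g = 4 * u + 8 ∨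
      (4 * u + 9 ≤ g ∧ g ≤ 5 * u + 8) ∨ g = 5 * u + 9 ∨ g = 5 * u + 10 ∨
      (5 * u + 11 ≤ g ∧ g ≤ 6 * u + 11)) with
    h | h | h | h | h | h | h | h | h | h | h | h
  · exact Or.inl ⟨h, _, by omega, hT 0 1 (by omega) (by omega) (by omega)⟩
  all_goals right
  -- Small differences: one from each fan.
  · obtain ⟨k, hk⟩ : ∃ k, k + g = 2 * u + 3 := ⟨2 * u + 3 - g, by omega⟩
    obtain ⟨j, hj⟩ : ∃ j, j + 2 = g := ⟨g - 2, by omega⟩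
    refine ⟨k, by omega, 2 * u + 5 + j, by omega, by omega,
      hz k (by omega) (zigzag (2 * u + 4) k) (zigzag (2 * u + 4) (k + 1)) (by omega) (by omega) ?_,
      ht j (evenTail u j) (evenTail u (j + 1)) (by omega) (by omega) ?_⟩
    · simp only [zigzag]
      split_ifs <;> omega
    · simp only [evenTail]
      split_ifs <;> omega
  · exact ⟨_, by omega, _, by omega, by omega,
      hC (3 * u + 7) (5 * u + 11) (by omega) (by omega) (by omega),
      hS (10 * u + 20) 1 (by omega) (by omega) (by omega)⟩
  -- Distance from 0 to the zigzag term common to two consecutive triples.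
  · obtain ⟨i, hi⟩ : ∃ i, i + (2 * u + 5) = g := ⟨g - (2 * u + 5), by omega⟩
    refine ⟨2 * i, by omega, 2 * i + 1, by omega, by omega,
      hz (2 * i) (by omega) 0 (zigzag (2 * u + 4) (2 * i + 1)) (by omega) (by omega) ?_,
      hz (2 * i + 1) (by omega) 0 (zigzag (2 * u + 4) (2 * i + 1)) (by omega) (by omega) ?_⟩ <;>
    · simp only [zigzag]
      split_ifs <;> omega
  · exact ⟨_, by omega, _, by omega, by omega,
      hT 1 (3 * u + 7) (by omega) (by omega) (by omega),
      hC 1 (3 * u + 7) (by omega) (by omega) (by omega)⟩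
  · refine ⟨2 * u + 1, by omega, 2 * u + 2, by omega, by omega,
      hz (2 * u + 1) (by omega) 0 (zigzag (2 * u + 4) (2 * u + 1 + 1)) (by omega) (by omega) ?_,
      hT 0 (3 * u + 7) (by omega) (by omega) (by omega)⟩
    simp only [zigzag]
    split_ifs <;> omega
  · obtain ⟨i, hi⟩ : ∃ i, i + g = 4 * u + 7 := ⟨4 * u + 7 - g, by omega⟩
    refine ⟨2 * i + 1, by omega, 2 * i + 2, by omega, by omega,
      hz (2 * i + 1) (by omega) 0 (zigzag (2 * u + 4) (2 * i + 1 + 1)) (by omega) (by omega) ?_,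
      hz (2 * i + 2) (by omega) 0 (zigzag (2 * u + 4) (2 * i + 2)) (by omega) (by omega) ?_⟩ <;>
    · simp only [zigzag]
      split_ifs <;> omega
  -- The outer ends of the two fans share the difference 4u + 8.
  · refine ⟨0, by omega, 2 * u + 5 + (2 * u + 1), by omega, by omega,
      hz 0 (by omega) 0 (zigzag (2 * u + 4) 0) (by omega) (by omega) ?_,
      ht (2 * u + 1) (10 * u + 20) (evenTail u (2 * u + 1 + 1)) (by omega) (by omega) ?_⟩
    · simp only [zigzag]
      split_ifs <;> omega
    · simp only [evenTail]
      split_ifs <;> omega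
  · obtain ⟨i, hi⟩ : ∃ i, i + g = 5 * u + 8 := ⟨5 * u + 8 - g, by omega⟩
    refine ⟨2 * u + 5 + (2 * i + 1), by omega, 2 * u + 5 + (2 * i + 2), by omega, by omega,
      ht (2 * i + 1) (10 * u + 20) (evenTail u (2 * i + 1 + 1)) (by omega) (by omega) ?_,
      ht (2 * i + 2) (10 * u + 20) (evenTail u (2 * i + 2)) (by omega) (by omega) ?_⟩ <;>
    · simp only [evenTail]
      split_ifs <;> omega
  · refine ⟨2 * u + 4, by omega, 2 * u + 5 + 0, by omega, by omega,
      hS (5 * u + 11) (10 * u + 20) (by omega) (by omega) (by omega),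
      ht 0 (10 * u + 20) (evenTail u 0) (by omega) (by omega) ?_⟩
    simp only [evenTail]
    split_ifs <;> omega
  · exact ⟨_, by omega, _, by omega, by omega,
      hC 1 (5 * u + 11) (by omega) (by omega) (by omega),
      hS 1 (5 * u + 11) (by omega) (by omega) (by omega)⟩
  · obtain ⟨i, hi⟩ : ∃ i, i + (5 * u + 11) = g := ⟨g - (5 * u + 11), by omega⟩
    refine ⟨2 * u + 5 + 2 * i, by omega, 2 * u + 5 + (2 * i + 1), by omega, by omega,
      ht (2 * i) (10 * u + 20) (evenTail u (2 * i + 1)) (by omega) (by omega) ?_,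
      ht (2 * i + 1) (10 * u + 20) (evenTail u (2 * i + 1)) (by omega) (by omega) ?_⟩ <;>
    · simp only [evenTail]
      split_ifs <;> omega

/-- The common difference 4u + 8 is aligned: {0, 4u + 8} shifted to {6u + 12, 10u + 20}. This
dictates c = 6u + 12, the inverse of 2. -/
theorem card_evenBase_inter_wrap :
    (residueTriple (12 * u + 23) (evenBase u (4 * u + 7 - 1)) ∩
      residueTranslate (residueTriple (12 * u + 23) (evenBase u 0))
        ((6 * u + 12 : ℕ) : ZMod (12 * u + 23))).card = 2 := by
  have h₁ : evenBase u (4 * u + 7 - 1) = (10 * u + 20, 4 * u + 9, 6 * u + 12) := by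
    rw [show 4 * u + 7 - 1 = 2 * u + 5 + (2 * u + 1) by omega, evenBase_tail]
    simp only [evenTail, Prod.mk.injEq, true_and]
    split_ifs <;> omega
  have h₀ : evenBase u 0 = (0, 4 * u + 8, 2 * u + 5) := by
    rw [evenBase_zigzag (by omega)]
    simp [zigzag]
    omega
  rw [h₀, h₁, residueTranslate_residueTriple (t' := (6 * u + 12, 10 * u + 20, 8 * u + 17))
    (by push_cast; ring) (by push_cast; ring) (by push_cast; ring)]
  refine card_residueTriple_inter ?_ ?_ (6 * u + 12) (10 * u + 20) (4 * u + 9) ?_ ?_ ?_ ?_ ?_ ?_ ?_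
    <;> simp [IsEntry, IsProperTriple] <;> omega

/-- The aligned difference is 2u + 4, which wraps around the modulus in the first triple. -/
theorem card_evenBase_S_inter_C :
    (residueTriple (12 * u + 23) (evenBase u (2 * u + 4)) ∩
      residueTranslate (residueTriple (12 * u + 23) (evenBase u (2 * u + 3)))
        ((7 * u + 13 : ℕ) : ZMod (12 * u + 23))).card = 2 := by
  have hN : ((12 * u + 23 : ℕ) : ZMod (12 * u + 23)) = 0 := ZMod.natCast_self _
  push_cast at hN
  rw [evenBase_S, evenBase_C, residueTranslate_residueTriple (t' := (7 * u + 14, 10 * u + 20, 1))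
    (by push_cast; ring) (by push_cast; ring) (by push_cast; linear_combination hN)]
  refine card_residueTriple_inter ?_ ?_ 1 (10 * u + 20) (5 * u + 11) ?_ ?_ ?_ ?_ ?_ ?_ ?_
    <;> simp [IsEntry, IsProperTriple] <;> omega

/-- The aligned difference is 2. -/
theorem card_evenBase_tail_inter_zigzag :
    (residueTriple (12 * u + 23) (evenBase u (2 * u + 5)) ∩
      residueTranslate (residueTriple (12 * u + 23) (evenBase u (2 * u + 1)))
        ((2 * u + 4 : ℕ) : ZMod (12 * u + 23))).card = 2 := by
  have h₁ : evenBase u (2 * u + 5) = (10 * u + 20, 5 * u + 11, 5 * u + 9) := evenBase_tail 0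
  have h₀ : evenBase u (2 * u + 1) = (0, 3 * u + 5, 3 * u + 7) := by
    rw [evenBase_zigzag (by omega)]
    simp only [zigzag, Prod.mk.injEq, true_and]
    split_ifs <;> omega
  rw [h₀, h₁, residueTranslate_residueTriple (t' := (2 * u + 4, 5 * u + 9, 5 * u + 11))
    (by push_cast; ring) (by push_cast; ring) (by push_cast; ring)]
  refine card_residueTriple_inter ?_ ?_ (5 * u + 9) (5 * u + 11) (10 * u + 20) ?_ ?_ ?_ ?_ ?_ ?_ ?_
    <;> simp [IsEntry, IsProperTriple] <;> omega

/-- The same adjacency as in `card_evenBase_S_inter_C`, read from the other side: 5u + 10 = -(7u +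
13). -/
theorem card_evenBase_C_inter_S :
    (residueTriple (12 * u + 23) (evenBase u (2 * u + 3)) ∩
      residueTranslate (residueTriple (12 * u + 23) (evenBase u (2 * u + 4)))
        ((5 * u + 10 : ℕ) : ZMod (12 * u + 23))).card = 2 := by
  have hN : ((12 * u + 23 : ℕ) : ZMod (12 * u + 23)) = 0 := ZMod.natCast_self _
  push_cast at hN
  rw [evenBase_S, evenBase_C,
    residueTranslate_residueTriple (t' := (5 * u + 11, 10 * u + 21, 3 * u + 7))
    (by push_cast; ring) (by push_cast; ring) (by push_cast; linear_combination hN)]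
  refine card_residueTriple_inter ?_ ?_ (3 * u + 7) (5 * u + 11) 1 ?_ ?_ ?_ ?_ ?_ ?_ ?_
    <;> simp [IsEntry, IsProperTriple] <;> omega

/-- A rotational TTS(`12u + 24`) with a Hamiltonian 2-block-intersection graph. -/
theorem exists_isHamiltonian_tts_twelve_mul_add_twentyfour (u : ℕ) :
    ∃ D : TTS (Fin (12 * u + 23 + 1)) (12 * u + 23 + 1),
      (D.blockIntersectionGraph 2).IsHamiltonian := by
  have hN : ((12 * u + 23 : ℕ) : ZMod (12 * u + 23)) = 0 := ZMod.natCast_self _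
  push_cast at hN
  have hadj := card_positionBlock_inter_succ (n := 4 * u + 7)
    (B := fun k => residueTriple (12 * u + 23) (evenBase u k)) (by omega)
    (fun k hk => card_evenBase_inter_succ hk) card_evenBase_inter_wrap
  obtain ⟨l, hperm, hchain, hhead, hlast⟩ := exists_isChain_four_segments
    (R := fun p q => (positionBlock (4 * u + 7)
      (fun k => residueTriple (12 * u + 23) (evenBase u k)) ((6 * u + 12 : ℕ) : ZMod (12 * u + 23)) p ∩
        positionBlock (4 * u + 7) (fun k => residueTriple (12 * u + 23) (evenBase u k))
          ((6 * u + 12 : ℕ) : ZMod (12 * u + 23)) q).card = 2)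
    (fun p q h => by rwa [Finset.inter_comm]) hadj
    -- The path runs from {0, 1, 3u + 7} in round 2, translated by 2c = 1, to the same triple in
    -- round N, translated by 0. As c is the inverse of 2, a chord with shift σ joins rounds that
    -- differ by 2σ modulo N; this fixes the other rounds.
    (s₀ := (4 * u + 7) * 0 + (2 * u + 3)) (s₁ := (4 * u + 7) * 2 + (2 * u + 2))
    (s₂ := (4 * u + 7) * (8 * u + 17) + (2 * u + 5))
    (s₃ := (4 * u + 7) * (10 * u + 20) + (2 * u + 4))
    (s₄ := (4 * u + 7) * (12 * u + 23) + (2 * u + 3))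
    (by omega) (by nlinarith) (by nlinarith) (by nlinarith)
    (card_positionBlock_inter (k := 2 * u + 4) (k' := 2 * u + 3) (by omega) (by omega) _
      (by push_cast; linear_combination (u + 1 : ZMod (12 * u + 23)) * hN) card_evenBase_S_inter_C)
    (card_positionBlock_inter (k := 2 * u + 5) (k' := 2 * u + 1) (by omega) (by omega) _
      (by push_cast; linear_combination -(4 * u + 8 : ZMod (12 * u + 23)) * hN)
      card_evenBase_tail_inter_zigzag)
    (card_positionBlock_inter (k := 2 * u + 3) (k' := 2 * u + 4) (by omega) (by omega) _
      (by push_cast; linear_combination (5 * u + 10 : ZMod (12 * u + 23)) * hN)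
      card_evenBase_C_inter_S)
  have hT : ∀ (t : ℕ) (y : ZMod (12 * u + 23)), y ∈ positionBlock (4 * u + 7)
      (fun k => residueTriple (12 * u + 23) (evenBase u k)) ((6 * u + 12 : ℕ) : ZMod (12 * u + 23))
      ((4 * u + 7) * t + (2 * u + 2)) ↔ y - (6 * u + 12) * t ∈ ({0, 1, 3 * (u : ZMod (12 * u + 23)) + 7} :
        Finset (ZMod (12 * u + 23))) := by
    intro t y
    rw [positionBlock_mul_add (by omega), mem_residueTranslate, evenBase_T, residueTriple]
    push_cast
    rfl
  refine exists_tts_of_rotational (n := 4 * u + 7) (d := 1) (c' := 2) (by omega) (by omega)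
    (fun k hk => (isProperTriple_evenBase hk).card)
    (by push_cast; linear_combination hN) isUnit_one ?_ ?_ (s := 2 * u + 3) ?_ hchain hhead hlast 0
    ?_ ?_ ?_ ?_
  · have h := natCast_residue_inj (N := 12 * u + 23) (a := 2) (b := 0) (by omega) (by omega)
    simpa using h
  · intro g hg hg'
    rcases evenBase_hasDifference (u := u) hg hg' with ⟨h, k, hk, hd⟩ | ⟨k, hk, k', hk', hne, hd, hd'⟩
    · exact Or.inl ⟨by rw [h, Nat.cast_one], k, hk, hd.exists_mem⟩
    · exact Or.inr ⟨k, hk, k', hk', hne, hd.exists_mem, hd'.exists_mem⟩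
  · rwa [mul_zero, zero_add, add_comm _ (2 * u + 3)] at hperm
  · exact (hT _ _).2 (by
      rw [ZMod.natCast_self, mul_zero, sub_zero]
      simp)
  · exact (hT _ _).2 (by
      rw [ZMod.natCast_self, mul_zero, sub_zero]
      simp)
  · rw [hT, show (0 + 1 - (6 * u + 12) * (2 : ℕ) : ZMod (12 * u + 23)) = 0 by
      push_cast; linear_combination -hN]
    simp
  · rw [hT, show (0 + 1 + 1 - (6 * u + 12) * (2 : ℕ) : ZMod (12 * u + 23)) = 1 by
      push_cast; linear_combination -hN]
    simp

end EvenCase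

/-! ### The modulus 12u + 29 -/

section OddCase

/-- The sequence `5u + 13, 5u + 12, 5u + 10, 5u + 14, 5u + 9, 5u + 15, …`. -/
def oddTail (u j : ℕ) : ℕ :=
  if j = 0 then 5 * u + 13
  else if j = 1 then 5 * u + 12
  else if j % 2 = 0 then 5 * u + 11 - j / 2 else 5 * u + 13 + j / 2

/-- The base blocks modulo `12u + 29`. -/
def oddBase (u k : ℕ) : ℕ × ℕ × ℕ :=
  if k < 2 * u + 4 then (0, zigzag (2 * u + 5) k, zigzag (2 * u + 5) (k + 1))
  else if k = 2 * u + 4 then (0, 3 * u + 8, 5 * u + 13)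
  else if k = 2 * u + 5 then (0, 5 * u + 13, 10 * u + 24)
  else (10 * u + 24, oddTail u (k - (2 * u + 6)), oddTail u (k - (2 * u + 6) + 1))

variable {u : ℕ}

theorem oddTail_cases (u j : ℕ) :
    j = 0 ∧ oddTail u j = 5 * u + 13 ∨ j = 1 ∧ oddTail u j = 5 * u + 12 ∨
      2 ≤ j ∧ j % 2 = 0 ∧ oddTail u j = 5 * u + 11 - j / 2 ∨
        2 ≤ j ∧ j % 2 = 1 ∧ oddTail u j = 5 * u + 13 + j / 2 := by
  rw [oddTail]
  split_ifs <;> omega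

theorem oddBase_zigzag {k : ℕ} (hk : k < 2 * u + 4) :
    oddBase u k = (0, zigzag (2 * u + 5) k, zigzag (2 * u + 5) (k + 1)) := by
  rw [oddBase, if_pos hk]

theorem oddBase_C : oddBase u (2 * u + 4) = (0, 3 * u + 8, 5 * u + 13) := by
  simp [oddBase]

theorem oddBase_S : oddBase u (2 * u + 5) = (0, 5 * u + 13, 10 * u + 24) := by
  simp [oddBase]

theorem oddBase_tail (j : ℕ) :
    oddBase u (2 * u + 6 + j) = (10 * u + 24, oddTail u j, oddTail u (j + 1)) := by
  rw [oddBase, if_neg (by omega), if_neg (by omega), if_neg (by omega), Nat.add_sub_cancel_left]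

theorem odd_index_cases {k : ℕ} (hk : k < 4 * u + 9) :
    k < 2 * u + 4 ∨ k = 2 * u + 4 ∨ k = 2 * u + 5 ∨ ∃ j, j < 2 * u + 3 ∧ k = 2 * u + 6 + j := by
  by_cases h : 2 * u + 6 ≤ k
  · exact Or.inr (Or.inr (Or.inr ⟨k - (2 * u + 6), by omega, by omega⟩))
  · omega

theorem isProperTriple_oddBase {k : ℕ} (hk : k < 4 * u + 9) :
    IsProperTriple (12 * u + 29) (oddBase u k) := by
  rcases odd_index_cases hk with h | rfl | rfl | ⟨j, hj, rfl⟩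
  · rw [oddBase_zigzag h]
    simp only [IsProperTriple, zigzag]
    split_ifs <;> omega
  · rw [oddBase_C]
    simp only [IsProperTriple]
    omega
  · rw [oddBase_S]
    simp only [IsProperTriple]
    omega
  · rw [oddBase_tail]
    have h₀ := oddTail_cases u j
    have h₁ := oddTail_cases u (j + 1)
    simp only [IsProperTriple]
    omega

theorem card_oddBase_inter_succ {k : ℕ} (hk : k + 1 < 4 * u + 9) :
    (residueTriple (12 * u + 29) (oddBase u k) ∩
      residueTriple (12 * u + 29) (oddBase u (k + 1))).card = 2 := by
  have h₀ := isProperTriple_oddBase (u := u) (k := k) (by omega)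
  have h₁ := isProperTriple_oddBase (u := u) (k := k + 1) hk
  rcases odd_index_cases (u := u) (k := k) (by omega) with h | rfl | rfl | ⟨j, hj, rfl⟩
  · by_cases h' : k + 1 < 2 * u + 4
    · rw [oddBase_zigzag h] at h₀ ⊢
      rw [oddBase_zigzag h'] at h₁ ⊢
      refine card_residueTriple_inter h₀ h₁ 0 (zigzag (2 * u + 5) (k + 1))
        (zigzag (2 * u + 5) k) ?_ (Or.inl rfl) (Or.inr (Or.inr rfl)) (Or.inl rfl)
        (Or.inr (Or.inl rfl)) (Or.inr (Or.inl rfl)) ?_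
      all_goals
        simp only [IsEntry, zigzag]
        split_ifs <;> omega
    · obtain rfl : k = 2 * u + 3 := by omega
      rw [oddBase_zigzag h] at h₀ ⊢
      rw [show 2 * u + 3 + 1 = 2 * u + 4 by rfl, oddBase_C] at h₁ ⊢
      refine card_residueTriple_inter h₀ h₁ 0 (3 * u + 8) (zigzag (2 * u + 5) (2 * u + 3))
        (by omega) (Or.inl rfl) (Or.inr (Or.inr ?_)) (Or.inl rfl) (Or.inr (Or.inl rfl))
        (Or.inr (Or.inl rfl)) ?_
      all_goals
        simp only [IsEntry, zigzag]
        split_ifs <;> omega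
  · rw [oddBase_C] at h₀ ⊢
    rw [show 2 * u + 4 + 1 = 2 * u + 5 by rfl, oddBase_S] at h₁ ⊢
    refine card_residueTriple_inter h₀ h₁ 0 (5 * u + 13) (3 * u + 8) ?_ ?_ ?_ ?_ ?_ ?_ ?_ <;>
      simp [IsEntry] <;> omega
  · rw [oddBase_S] at h₀ ⊢
    rw [show 2 * u + 5 + 1 = 2 * u + 6 + 0 by rfl, oddBase_tail] at h₁ ⊢
    refine card_residueTriple_inter h₀ h₁ (5 * u + 13) (10 * u + 24) 0 ?_ ?_ ?_ ?_ ?_ ?_ ?_ <;>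
      (try simp [IsEntry, oddTail]) <;> omega
  · rw [oddBase_tail] at h₀ ⊢
    rw [add_assoc (2 * u + 6) j 1, oddBase_tail] at h₁ ⊢
    have e₀ := oddTail_cases u j
    have e₁ := oddTail_cases u (j + 1)
    have e₂ := oddTail_cases u (j + 1 + 1)
    refine card_residueTriple_inter h₀ h₁ (10 * u + 24) (oddTail u (j + 1)) (oddTail u j)
      ?_ (Or.inl rfl) (Or.inr (Or.inr rfl)) (Or.inl rfl)
        (Or.inr (Or.inl rfl)) (Or.inr (Or.inl rfl)) ?_
    · omega
    · simp only [IsEntry]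
      omega

/-- As for the other modulus, but the tail starts with steps 1, 2, 4, 5, …: skipping 3 leaves that
difference only in the fan at 0, so d = 3. The tail thereby also skips the distance 5u + 13 to its
apex, which the two connecting triples supply. -/
theorem oddBase_hasDifference {g : ℕ} (h1 : 1 ≤ g) (h2 : 2 * g ≤ 12 * u + 29) :
    (g = 3 ∧ ∃ k < 4 * u + 9, HasDifference (12 * u + 29) (oddBase u k) g) ∨
    ∃ k < 4 * u + 9, ∃ k' < 4 * u + 9, k ≠ k' ∧
      HasDifference (12 * u + 29) (oddBase u k) g ∧
      HasDifference (12 * u + 29) (oddBase u k') g := by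
  have hz : ∀ k, k < 2 * u + 4 → ∀ x y, (x = 0 ∨ x = zigzag (2 * u + 5) k ∨
      x = zigzag (2 * u + 5) (k + 1)) → (y = 0 ∨ y = zigzag (2 * u + 5) k ∨
      y = zigzag (2 * u + 5) (k + 1)) → (x + g = y ∨ y + g = x ∨ x + g = y + (12 * u + 29)) →
      HasDifference (12 * u + 29) (oddBase u k) g := by
    intro k hk x y hx hy h
    rw [oddBase_zigzag hk]
    exact ⟨x, y, hx, hy, h⟩
  have ht : ∀ j, ∀ x y, (x = 10 * u + 24 ∨ x = oddTail u j ∨ x = oddTail u (j + 1)) →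
      (y = 10 * u + 24 ∨ y = oddTail u j ∨ y = oddTail u (j + 1)) →
      (x + g = y ∨ y + g = x ∨ x + g = y + (12 * u + 29)) →
      HasDifference (12 * u + 29) (oddBase u (2 * u + 6 + j)) g := by
    intro j x y hx hy h
    rw [oddBase_tail]
    exact ⟨x, y, hx, hy, h⟩
  have hC : ∀ x y, (x = 0 ∨ x = 3 * u + 8 ∨ x = 5 * u + 13) →
      (y = 0 ∨ y = 3 * u + 8 ∨ y = 5 * u + 13) →
      (x + g = y ∨ y + g = x ∨ x + g = y + (12 * u + 29)) →
      HasDifference (12 * u + 29) (oddBase u (2 * u + 4)) g := by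
    intro x y hx hy h
    rw [oddBase_C]
    exact ⟨x, y, hx, hy, h⟩
  have hS : ∀ x y, (x = 0 ∨ x = 5 * u + 13 ∨ x = 10 * u + 24) →
      (y = 0 ∨ y = 5 * u + 13 ∨ y = 10 * u + 24) →
      (x + g = y ∨ y + g = x ∨ x + g = y + (12 * u + 29)) →
      HasDifference (12 * u + 29) (oddBase u (2 * u + 5)) g := by
    intro x y hx hy h
    rw [oddBase_S]
    exact ⟨x, y, hx, hy, h⟩
  have hzz : ∀ k, k + g = 2 * u + 4 → HasDifference (12 * u + 29) (oddBase u k) g := by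
    intro k hk
    refine hz k (by omega) (zigzag (2 * u + 5) k) (zigzag (2 * u + 5) (k + 1)) (by omega)
      (by omega) ?_
    simp only [zigzag]
    split_ifs <;> omega
  have hz0 : ∀ k, k < 2 * u + 4 → g = zigzag (2 * u + 5) k →
      HasDifference (12 * u + 29) (oddBase u k) g := fun k hk hg =>
    hz k hk 0 (zigzag (2 * u + 5) k) (by omega) (by omega) (by omega)
  have hz1 : ∀ k, k < 2 * u + 4 → g = zigzag (2 * u + 5) (k + 1) →
      HasDifference (12 * u + 29) (oddBase u k) g := fun k hk hg =>
    hz k hk 0 (zigzag (2 * u + 5) (k + 1)) (by omega) (by omega) (by omega)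
  have htt : ∀ j, (oddTail u j + g = oddTail u (j + 1) ∨ oddTail u (j + 1) + g = oddTail u j) →
      HasDifference (12 * u + 29) (oddBase u (2 * u + 6 + j)) g := fun j h =>
    ht j (oddTail u j) (oddTail u (j + 1)) (by omega) (by omega) (by omega)
  have ht0 : ∀ j, oddTail u j + g = 10 * u + 24 →
      HasDifference (12 * u + 29) (oddBase u (2 * u + 6 + j)) g := fun j h =>
    ht j (oddTail u j) (10 * u + 24) (by omega) (by omega) (by omega)
  have ht1 : ∀ j, oddTail u (j + 1) + g = 10 * u + 24 →
      HasDifference (12 * u + 29) (oddBase u (2 * u + 6 + j)) g := fun j h =>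
    ht j (oddTail u (j + 1)) (10 * u + 24) (by omega) (by omega) (by omega)
  rcases (by omega : g = 3 ∨ g = 1 ∨ g = 2 ∨ (4 ≤ g ∧ g ≤ 2 * u + 4) ∨ g = 2 * u + 5 ∨
      (2 * u + 6 ≤ g ∧ g ≤ 3 * u + 7) ∨ g = 3 * u + 8 ∨
      (3 * u + 9 ≤ g ∧ g ≤ 4 * u + 9) ∨ g = 4 * u + 10 ∨
      (4 * u + 11 ≤ g ∧ g ≤ 5 * u + 10) ∨ g = 5 * u + 11 ∨ g = 5 * u + 12 ∨ g = 5 * u + 13 ∨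
      (5 * u + 14 ≤ g ∧ g ≤ 6 * u + 14)) with
    h | h | h | h | h | h | h | h | h | h | h | h | h | h
  · exact Or.inl ⟨h, 2 * u + 1, by omega, hzz _ (by omega)⟩
  all_goals right
  · exact ⟨2 * u + 3, by omega, 2 * u + 6 + 0, by omega, by omega, hzz _ (by omega),
      htt 0 (by simp [oddTail]; omega)⟩
  · exact ⟨2 * u + 2, by omega, 2 * u + 6 + 1, by omega, by omega, hzz _ (by omega),
      htt 1 (by simp [oddTail]; omega)⟩
  · obtain ⟨k, hk⟩ : ∃ k, k + g = 2 * u + 4 := ⟨2 * u + 4 - g, by omega⟩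
    obtain ⟨j, hj⟩ : ∃ j, j + 2 = g := ⟨g - 2, by omega⟩
    refine ⟨k, by omega, 2 * u + 6 + j, by omega, by omega, hzz k hk, htt j ?_⟩
    have h₀ := oddTail_cases u j
    have h₁ := oddTail_cases u (j + 1)
    omega
  · exact ⟨_, by omega, _, by omega, by omega,
      hC (3 * u + 8) (5 * u + 13) (by omega) (by omega) (by omega),
      hS (10 * u + 24) 0 (by omega) (by omega) (by omega)⟩
  · obtain ⟨i, hi⟩ : ∃ i, i + (2 * u + 6) = g := ⟨g - (2 * u + 6), by omega⟩
    refine ⟨2 * i, by omega, 2 * i + 1, by omega, by omega, hz1 _ (by omega) ?_,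
      hz0 _ (by omega) ?_⟩ <;>
    · simp only [zigzag]
      split_ifs <;> omega
  · refine ⟨2 * u + 3, by omega, 2 * u + 4, by omega, by omega, hz1 _ (by omega) ?_,
      hC 0 (3 * u + 8) (by omega) (by omega) (by omega)⟩
    simp only [zigzag]
    split_ifs <;> omega
  · obtain ⟨i, hi⟩ : ∃ i, i + g = 4 * u + 9 := ⟨4 * u + 9 - g, by omega⟩
    refine ⟨2 * i + 1, by omega, 2 * i + 2, by omega, by omega, hz1 _ (by omega) ?_,
      hz0 _ (by omega) ?_⟩ <;>
    · simp only [zigzag]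
      split_ifs <;> omega
  · refine ⟨0, by omega, 2 * u + 6 + (2 * u + 2), by omega, by omega, hz0 _ (by omega) ?_,
      ht1 _ ?_⟩
    · simp only [zigzag]
      split_ifs <;> omega
    · have := oddTail_cases u (2 * u + 2 + 1)
      omega
  · obtain ⟨i, hi⟩ : ∃ i, i + g = 5 * u + 10 := ⟨5 * u + 10 - g, by omega⟩
    refine ⟨2 * u + 6 + (2 * i + 2), by omega, 2 * u + 6 + (2 * i + 3), by omega, by omega,
      ht1 _ ?_, ht0 _ ?_⟩ <;>
    · have := oddTail_cases u (2 * i + 2 + 1)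
      change oddTail u (2 * i + 2 + 1) + g = _
      omega
  · exact ⟨2 * u + 5, by omega, 2 * u + 6 + 0, by omega, by omega,
      hS (5 * u + 13) (10 * u + 24) (by omega) (by omega) (by omega),
      ht0 0 (by simp [oddTail]; omega)⟩
  · exact ⟨2 * u + 6 + 0, by omega, 2 * u + 6 + 1, by omega, by omega,
      ht1 0 (by simp [oddTail]; omega), ht0 1 (by simp [oddTail]; omega)⟩
  · exact ⟨_, by omega, _, by omega, by omega,
      hC 0 (5 * u + 13) (by omega) (by omega) (by omega),
      hS 0 (5 * u + 13) (by omega) (by omega) (by omega)⟩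
  · obtain ⟨i, hi⟩ : ∃ i, i + (5 * u + 14) = g := ⟨g - (5 * u + 14), by omega⟩
    refine ⟨2 * u + 6 + (2 * i + 1), by omega, 2 * u + 6 + (2 * i + 2), by omega, by omega,
      ht1 _ ?_, ht0 _ ?_⟩ <;>
    · have := oddTail_cases u (2 * i + 1 + 1)
      change oddTail u (2 * i + 1 + 1) + g = _
      omega

/-- The outer ends of the fans share the difference 4u + 10. Aligning it gives c = 6u + 14, and -2c
= 1. -/
theorem card_oddBase_inter_wrap :
    (residueTriple (12 * u + 29) (oddBase u (4 * u + 9 - 1)) ∩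
      residueTranslate (residueTriple (12 * u + 29) (oddBase u 0))
        ((6 * u + 14 : ℕ) : ZMod (12 * u + 29))).card = 2 := by
  have h₁ : oddBase u (4 * u + 9 - 1) = (10 * u + 24, 4 * u + 10, 6 * u + 14) := by
    rw [show 4 * u + 9 - 1 = 2 * u + 6 + (2 * u + 2) by omega, oddBase_tail]
    have e₀ := oddTail_cases u (2 * u + 2)
    have e₁ := oddTail_cases u (2 * u + 2 + 1)
    simp only [Prod.mk.injEq, true_and]
    omega
  have h₀ : oddBase u 0 = (0, 4 * u + 10, 2 * u + 6) := by
    rw [oddBase_zigzag (by omega)]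
    simp [zigzag]
    omega
  rw [h₀, h₁, residueTranslate_residueTriple (t' := (6 * u + 14, 10 * u + 24, 8 * u + 20))
    (by push_cast; ring) (by push_cast; ring) (by push_cast; ring)]
  refine card_residueTriple_inter ?_ ?_ (6 * u + 14) (10 * u + 24) (4 * u + 10) ?_ ?_ ?_ ?_ ?_ ?_ ?_
    <;> simp [IsEntry, IsProperTriple] <;> omega

/-- The three chord types align a step common to both fans: 2 here, then 4 and 1. -/
theorem card_oddBase_zigzag_inter_tail_one :
    (residueTriple (12 * u + 29) (oddBase u (2 * u + 2)) ∩
      residueTranslate (residueTriple (12 * u + 29) (oddBase u (2 * u + 7)))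
        ((10 * u + 26 : ℕ) : ZMod (12 * u + 29))).card = 2 := by
  have hN : ((12 * u + 29 : ℕ) : ZMod (12 * u + 29)) = 0 := ZMod.natCast_self _
  push_cast at hN
  have h₀ : oddBase u (2 * u + 2) = (0, 3 * u + 9, 3 * u + 7) := by
    rw [oddBase_zigzag (by omega)]
    simp only [zigzag, Prod.mk.injEq, true_and]
    split_ifs <;> omega
  have h₁ : oddBase u (2 * u + 7) = (10 * u + 24, 5 * u + 12, 5 * u + 10) := oddBase_tail 1
  rw [h₀, h₁, residueTranslate_residueTriple (t' := (8 * u + 21, 3 * u + 9, 3 * u + 7))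
    (by push_cast; linear_combination hN) (by push_cast; linear_combination hN)
    (by push_cast; linear_combination hN)]
  refine card_residueTriple_inter ?_ ?_ (3 * u + 9) (3 * u + 7) 0 ?_ ?_ ?_ ?_ ?_ ?_ ?_
    <;> simp [IsEntry, IsProperTriple] <;> omega

theorem card_oddBase_zigzag_inter_tail_two :
    (residueTriple (12 * u + 29) (oddBase u (2 * u)) ∩
      residueTranslate (residueTriple (12 * u + 29) (oddBase u (2 * u + 8)))
        ((10 * u + 25 : ℕ) : ZMod (12 * u + 29))).card = 2 := by
  have hN : ((12 * u + 29 : ℕ) : ZMod (12 * u + 29)) = 0 := ZMod.natCast_self _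
  push_cast at hN
  have h₀ : oddBase u (2 * u) = (0, 3 * u + 10, 3 * u + 6) := by
    rw [oddBase_zigzag (by omega)]
    simp only [zigzag, Prod.mk.injEq, true_and]
    split_ifs <;> omega
  have h₁ : oddBase u (2 * u + 8) = (10 * u + 24, 5 * u + 10, 5 * u + 14) := oddBase_tail 2
  rw [h₀, h₁, residueTranslate_residueTriple (t' := (8 * u + 20, 3 * u + 6, 3 * u + 10))
    (by push_cast; linear_combination hN) (by push_cast; linear_combination hN)
    (by push_cast; linear_combination hN)]
  refine card_residueTriple_inter ?_ ?_ (3 * u + 10) (3 * u + 6) 0 ?_ ?_ ?_ ?_ ?_ ?_ ?_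
    <;> simp [IsEntry, IsProperTriple] <;> omega

theorem card_oddBase_tail_inter_zigzag :
    (residueTriple (12 * u + 29) (oddBase u (2 * u + 6)) ∩
      residueTranslate (residueTriple (12 * u + 29) (oddBase u (2 * u + 3)))
        ((2 * u + 5 : ℕ) : ZMod (12 * u + 29))).card = 2 := by
  have h₀ : oddBase u (2 * u + 3) = (0, 3 * u + 7, 3 * u + 8) := by
    rw [oddBase_zigzag (by omega)]
    simp only [zigzag, Prod.mk.injEq, true_and]
    split_ifs <;> omega
  have h₁ : oddBase u (2 * u + 6) = (10 * u + 24, 5 * u + 13, 5 * u + 12) := oddBase_tail 0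
  rw [h₀, h₁, residueTranslate_residueTriple (t' := (2 * u + 5, 5 * u + 12, 5 * u + 13))
    (by push_cast; ring) (by push_cast; ring) (by push_cast; ring)]
  refine card_residueTriple_inter ?_ ?_ (5 * u + 12) (5 * u + 13) (10 * u + 24) ?_ ?_ ?_ ?_ ?_ ?_ ?_
    <;> simp [IsEntry, IsProperTriple] <;> omega

/-- A rotational TTS(`12u + 30`) with a Hamiltonian 2-block-intersection graph. -/
theorem exists_isHamiltonian_tts_twelve_mul_add_thirty (u : ℕ) :
    ∃ D : TTS (Fin (12 * u + 29 + 1)) (12 * u + 29 + 1),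
      (D.blockIntersectionGraph 2).IsHamiltonian := by
  have hN : ((12 * u + 29 : ℕ) : ZMod (12 * u + 29)) = 0 := ZMod.natCast_self _
  push_cast at hN
  have hadj := card_positionBlock_inter_succ (n := 4 * u + 9)
    (B := fun k => residueTriple (12 * u + 29) (oddBase u k)) (by omega)
    (fun k hk => card_oddBase_inter_succ hk) card_oddBase_inter_wrap
  obtain ⟨l, hperm, hchain, hhead, hlast⟩ := exists_isChain_five_segments
    (R := fun p q => (positionBlock (4 * u + 9)
      (fun k => residueTriple (12 * u + 29) (oddBase u k)) ((6 * u + 14 : ℕ) : ZMod (12 * u + 29)) p ∩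
        positionBlock (4 * u + 9) (fun k => residueTriple (12 * u + 29) (oddBase u k))
          ((6 * u + 14 : ℕ) : ZMod (12 * u + 29)) q).card = 2)
    (fun p q h => by rwa [Finset.inter_comm]) hadj
    -- Both ends are translates of base triple 2u + 1, which contains the difference 3. Round 12u +
    -- 23 = -6 modulo N translates it by -6c = 3, round N by 0. A chord with shift σ joins rounds
    -- differing by -2σ; the first two chords are of the same type.
    (s₀ := (4 * u + 9) * 0 + (2 * u + 2)) (s₁ := (4 * u + 9) * (4 * u + 2) + (2 * u + 8))
    (s₂ := (4 * u + 9) * (4 * u + 6) + (2 * u + 7))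
    (s₃ := (4 * u + 9) * (12 * u + 23) + (2 * u + 1))
    (s₄ := (4 * u + 9) * (12 * u + 25) + (2 * u + 3))
    (s₅ := (4 * u + 9) * (12 * u + 29) + (2 * u + 2))
    (by nlinarith) (by nlinarith) (by nlinarith) (by nlinarith) (by nlinarith)
    (card_positionBlock_inter (k := 2 * u + 2) (k' := 2 * u + 7) (by omega) (by omega) _
      (by push_cast; linear_combination -(4 * u + 12 : ZMod (12 * u + 29)) * hN)
      card_oddBase_zigzag_inter_tail_one)
    (card_positionBlock_inter (k := 2 * u + 2) (k' := 2 * u + 7) (by omega) (by omega) _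
      (by push_cast; linear_combination (2 * u + 2 : ZMod (12 * u + 29)) * hN)
      card_oddBase_zigzag_inter_tail_one)
    (card_positionBlock_inter (k := 2 * u) (k' := 2 * u + 8) (by omega) (by omega) _
      (by push_cast; linear_combination -(4 * u + 11 : ZMod (12 * u + 29)) * hN)
      card_oddBase_zigzag_inter_tail_two)
    (card_positionBlock_inter (k := 2 * u + 6) (k' := 2 * u + 3) (by omega) (by omega) _
      (by push_cast; linear_combination (4 * u + 9 : ZMod (12 * u + 29)) * hN)
      card_oddBase_tail_inter_zigzag)
  have hb : oddBase u (2 * u + 1) = (0, 3 * u + 6, 3 * u + 9) := by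
    rw [oddBase_zigzag (by omega)]
    simp only [zigzag, Prod.mk.injEq, true_and]
    split_ifs <;> omega
  have hT : ∀ (t : ℕ) (y : ZMod (12 * u + 29)), y ∈ positionBlock (4 * u + 9)
      (fun k => residueTriple (12 * u + 29) (oddBase u k)) ((6 * u + 14 : ℕ) : ZMod (12 * u + 29))
      ((4 * u + 9) * t + (2 * u + 1)) ↔ y - (6 * u + 14) * t ∈
        ({0, 3 * (u : ZMod (12 * u + 29)) + 6, 3 * (u : ZMod (12 * u + 29)) + 9} :
          Finset (ZMod (12 * u + 29))) := by
    intro t y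
    rw [positionBlock_mul_add (by omega), mem_residueTranslate, hb, residueTriple]
    push_cast
    rfl
  refine exists_tts_of_rotational (n := 4 * u + 9) (d := 3) (c' := -2) (by omega) (by omega)
    (fun k hk => (isProperTriple_oddBase hk).card)
    (by push_cast; linear_combination -hN)
    (IsUnit.of_mul_eq_one (4 * u + 10) (by linear_combination hN)) ?_ ?_ (s := 2 * u + 2) ?_
    hchain hhead hlast (3 * u + 6) ?_ ?_ ?_ ?_
  · have h := natCast_residue_inj (N := 12 * u + 29) (a := 6) (b := 0) (by omega) (by omega)
    intro h'
    exact absurd (h.1 (by push_cast; linear_combination h')) (by omega)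
  · intro g hg hg'
    rcases oddBase_hasDifference (u := u) hg hg' with ⟨h, k, hk, hd⟩ | ⟨k, hk, k', hk', hne, hd, hd'⟩
    · exact Or.inl ⟨by rw [h, Nat.cast_ofNat], k, hk, hd.exists_mem⟩
    · exact Or.inr ⟨k, hk, k', hk', hne, hd.exists_mem, hd'.exists_mem⟩
  · rwa [mul_zero, zero_add, add_comm _ (2 * u + 2)] at hperm
  · exact (hT _ _).2 (by
      rw [ZMod.natCast_self, mul_zero, sub_zero]
      simp)
  · exact (hT _ _).2 (by
      rw [ZMod.natCast_self, mul_zero, sub_zero, add_assoc]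
      norm_num)
  · rw [hT, show (3 * u + 6 + 3 - (6 * u + 14) * (12 * u + 23 : ℕ) : ZMod (12 * u + 29)) =
        3 * u + 6 by push_cast; linear_combination -(6 * u + 11 : ZMod (12 * u + 29)) * hN]
    simp
  · rw [hT, show (3 * u + 6 + 3 + 3 - (6 * u + 14) * (12 * u + 23 : ℕ) : ZMod (12 * u + 29)) =
        3 * u + 9 by push_cast; linear_combination -(6 * u + 11 : ZMod (12 * u + 29)) * hN]
    simp

end OddCase

/-! ### The two residue classes of v modulo 4 -/

/-- For odd `v ≥ 7` a TTS(`3v + 3`) with a Hamiltonian 2-block-intersection graph is constructed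
directly, so that the design `h` on `v` points is not needed. -/
theorem theorem8p0 (v : ℕ) (hv : 7 ≤ v) (hodd : Odd v)
    (h : ∃ D : TTS (Fin v) v, (D.blockIntersectionGraph 2).IsHamiltonian) :
    ∃ D : TTS (Fin (3 * v + 3)) (3 * v + 3), (D.blockIntersectionGraph 2).IsHamiltonian := by
  obtain ⟨w, rfl⟩ := hodd
  obtain ⟨t, rfl | rfl⟩ := Nat.even_or_odd' w
  -- Here v = 4t + 1, so v ≥ 7 gives t ≥ 2; in the other class v = 4t + 3 and t ≥ 1.
  · obtain ⟨u, rfl⟩ : ∃ u, t = u + 2 := ⟨t - 2, by omega⟩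
    rw [show 3 * (2 * (2 * (u + 2)) + 1) + 3 = 12 * u + 29 + 1 by ring]
    exact exists_isHamiltonian_tts_twelve_mul_add_thirty u
  · obtain ⟨u, rfl⟩ : ∃ u, t = u + 1 := ⟨t - 1, by omega⟩
    rw [show 3 * (2 * (2 * (u + 1) + 1) + 1) + 3 = 12 * u + 23 + 1 by ring]
    exact exists_isHamiltonian_tts_twelve_mul_add_twentyfour u
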